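/- Let $D\geq 1$ be a square-free integer, let $F=\mathbb{Q}(\sqrt{-D})\subset\mathbb{C}$ with ring of integers $\mathcal{O}_D$, and let $\Gamma_D=\operatorname{SL}_2(\mathcal{O}_D)$. For an integer $m\geq 1$ let $\Lambda(m)=\operatorname{Symm}^m_{\mathcal{O}_D}(\mathcal{O}_D^2)=\mathcal{O}_DX^m\oplus\mathcal{O}_DX^{m-1}Y\oplus\dots\oplus\mathcal{O}_DY^m$, with the action of $\Gamma_D$ induced by the standard action on $\mathcal{O}_D^2=\mathcal{O}_DX\oplus\mathcal{O}_DY$. Regard $\Lambda(m)$ as a free $\mathbb{Z}$-module of rank $2(m+1)$, let $\check\Lambda(m)=\operatorname{Hom}_{\mathbb{Z}}(\Lambda(m),\mathbb{Z})$ with the contragredient action, and let $\bar\Lambda(m)=\Lambda(m)\oplus\check\Lambda(m)$. Let $\Gamma\subseteq\Gamma_D$ be a torsion-free subgroup of finite index. Then there is a constant $c_\Gamma\in\mathbb{R}$, depending only on $\Gamma$, such that for every integer $m\geq 1$ the torsion subgroup $H^2(\Gamma,\bar\Lambda(m))_{tors}$ of the group cohomology is finite and $$\log\left|H^2(\Gamma,\bar\Lambda(m))_{tors}\right|\leq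 c_\Gamma\, m^2 .$$ -/

import Mathlib

open scoped MatrixGroups IntermediateField

noncomputable section

/-- The imaginary quadratic field `F = ℚ(√-D)`, as a subfield of `ℂ`. -/
abbrev ImagQuadField (D : ℕ) : IntermediateField ℚ ℂ :=
  ℚ⟮((Real.sqrt (D : ℝ) : ℝ) : ℂ) * Complex.I⟯

/-- The ring of integers `𝒪_D` of `ℚ(√-D)`. -/
abbrev ImagQuadIntegers (D : ℕ) : Type :=
  NumberField.RingOfIntegers (ImagQuadField D)

/-- The Bianchi group `Γ_D = SL₂(𝒪_D)`. -/
abbrev BianchiGroup (D : ℕ) : Type :=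
  Matrix.SpecialLinearGroup (Fin 2) (ImagQuadIntegers D)

namespace SymPow

/-- The symmetric power `Symm^m R²`, that is the degree `m` part
`R X^m ⊕ R X^(m-1) Y ⊕ ⋯ ⊕ R Y^m` of the symmetric algebra `R[X, Y]` of `R²`;
the variables `X = X 0` and `Y = X 1` are the standard basis vectors of `R²`. -/
abbrev Lattice (R : Type*) [CommRing R] (m : ℕ) : Type _ :=
  MvPolynomial.homogeneousSubmodule (Fin 2) R m

/-- The endomorphism of the symmetric algebra `R[X, Y]` of `R²` induced by `v ↦ γ v` on `R²`:
it sends the basis vector `X j` to `∑ i, γ i j • X i`. -/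
def subst {R : Type*} [CommRing R] (γ : Matrix (Fin 2) (Fin 2) R) :
    MvPolynomial (Fin 2) R →ₐ[R] MvPolynomial (Fin 2) R :=
  MvPolynomial.aeval fun j => ∑ i, MvPolynomial.C (γ i j) * MvPolynomial.X i

theorem subst_one {R : Type*} [CommRing R] :
    subst (1 : Matrix (Fin 2) (Fin 2) R) = AlgHom.id R _ := by
  ext j : 1
  simp [subst, Matrix.one_apply]

theorem subst_mul {R : Type*} [CommRing R] (γ δ : Matrix (Fin 2) (Fin 2) R) :
    subst (γ * δ) = (subst γ).comp (subst δ) := by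
  ext j : 1
  simp only [subst, AlgHom.comp_apply, MvPolynomial.aeval_X, Matrix.mul_apply, Fin.sum_univ_two,
    map_add, map_mul, MvPolynomial.aeval_C, MvPolynomial.algebraMap_eq]
  ring

theorem subst_mem {R : Type*} [CommRing R] (γ : Matrix (Fin 2) (Fin 2) R) {m : ℕ}
    {p : MvPolynomial (Fin 2) R} (hp : p ∈ MvPolynomial.homogeneousSubmodule (Fin 2) R m) :
    subst γ p ∈ MvPolynomial.homogeneousSubmodule (Fin 2) R m := by
  rw [MvPolynomial.mem_homogeneousSubmodule] at hp ⊢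
  have h := hp.aeval (fun j => ∑ i, MvPolynomial.C (γ i j) * MvPolynomial.X i) (n := 1)
    (fun j => MvPolynomial.IsHomogeneous.sum _ _ _ fun i _ =>
      (MvPolynomial.isHomogeneous_X R i).C_mul (γ i j))
  simpa [subst] using h

/-- The representation of `SL₂(R)` on `Symm^m R²`, regarded as a `ℤ`-module. -/
def rep (R : Type*) [CommRing R] (m : ℕ) :
    Representation ℤ (Matrix.SpecialLinearGroup (Fin 2) R) (Lattice R m) where
  toFun γ :=
    { toFun := fun p => ⟨subst (γ : Matrix (Fin 2) (Fin 2) R) p.1, subst_mem _ p.2⟩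
      map_add' := fun p q => Subtype.ext (map_add _ _ _)
      map_smul' := fun n p => Subtype.ext (map_zsmul _ _ _) }
  map_one' := by
    ext p : 2
    simp [subst_one]
  map_mul' γ δ := by
    ext p : 2
    simp [subst_mul]

end SymPow

/-- The `Γ_D`-module `Λ̄(m) = Λ(m) ⊕ Hom_ℤ(Λ(m), ℤ)` with `Λ(m) = Symm^m 𝒪_D²`, the second summand
with the contragredient action, restricted to a subgroup `Γ` of `Γ_D`. -/
def LambdaBar (D : ℕ) (Γ : Subgroup (BianchiGroup D)) (m : ℕ) : Rep ℤ Γ :=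
  Rep.of (((SymPow.rep (ImagQuadIntegers D) m).prod
    (SymPow.rep (ImagQuadIntegers D) m).dual).comp Γ.subtype)

end

/-! The bound follows from finite presentability of `Γ`. Suppose finitely many relations `a * b =
ab` with `a, b, ab ∈ S` present `Γ`. For a `ℤ`-free module `M`, a torsion class in `H²(Γ, M)` is
determined by the values of a representing cocycle on these relations, modulo coboundaries of
functions `S → M` (`exists_primitive`). So the torsion of `H²` injects into the torsion of the
cokernel of an integer matrix, which is at most a nonzero minor of maximal size
(`card_le_of_torsion_coker`). For `Λ̄(m)` the matrix has `O(m)` columns. Its entries are at most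
exponential in `m`, since a group element acts on `X^i Y^(m-i)` through a product of `m` linear
forms. A minor is therefore at most `(Km)! * C^(O(m²))`, and its logarithm is `O(m²)`.

Finite presentability comes from reduction theory. `SL₂(𝒪_D)` acts on the convex, hence simply
connected, cone of positive definite Hermitian forms, which is `cone 1`. Every form becomes almost
reduced in some pair of independent vectors of `𝒪_D²` of bounded determinant (`exists_reduction`);
up to `Γ` there are finitely many such pairs (`exists_finite_reps_subgroup`). Translates of a convex
Siegel set thus cover the cone with finitely many orbits, and each translate meets only finitely
many others (`exists_norm_le_of_conj_mem_siegel`). Such a cover of a simply connected space yields a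
presentation, because constant Čech cocycles on it are trivial. -/

/-! ### Finite presentations from covers of simply connected spaces -/

/-- Local systems on a simply connected space are trivial: a constant `H`-valued Čech `1`-cocycle on
an open cover by preconnected sets is a coboundary. -/
theorem exists_cech_trivialization {X J H : Type*} [TopologicalSpace X] [SimplyConnectedSpace X]
    [LocallyPathConnectedSpace X] [Group H] (V : J → Set X) (hopen : ∀ j, IsOpen (V j))
    (hconn : ∀ j, IsPreconnected (V j)) (hcov : ∀ x, ∃ j, x ∈ V j) (g : J → J → H)
    (hg : ∀ i j k, (V i ∩ V j ∩ V k).Nonempty → g i j * g j k = g i k) :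
    ∃ ψ : J → H, ∀ i j, (V i ∩ V j).Nonempty → ψ j = ψ i * g i j := by
  classical
  let : TopologicalSpace H := ⊥
  have : DiscreteTopology H := ⟨rfl⟩
  choose idx hidx using hcov
  -- With `H` discrete, gluing the sets `V j × H` by right translations gives a covering space of
  -- `X`.
  let Z : FiberBundleCore J X H :=
    { baseSet := V
      isOpen_baseSet := hopen
      indexAt := idx
      mem_baseSet_at := hidx
      coordChange := fun i j _ h => h * g i j
      coordChange_self := fun i x hx h => by
        have := hg i i i ⟨x, ⟨hx, hx⟩, hx⟩
        rw [mul_eq_left.mp this, mul_one]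
      continuousOn_coordChange := fun i j =>
        ((continuous_of_discreteTopology (f := fun h : H => h * g i j)).comp
          continuous_snd).continuousOn
      coordChange_comp := fun i j k x hx h => by
        rw [mul_assoc, hg i j k ⟨x, hx⟩] }
  have hcm : IsCoveringMap (Bundle.TotalSpace.proj : Z.TotalSpace → X) :=
    FiberBundle.isCoveringMap (F := H) (E := Z.Fiber)
  obtain ⟨x₀⟩ : Nonempty X := inferInstance
  -- Simple connectivity lifts the identity of `X` to a global section. Its coordinate over each
  -- preconnected `V i` is constant, and these constants are `ψ`.
  obtain ⟨F, ⟨-, hF⟩, -⟩ := hcm.existsUnique_continuousMap_lifts (ContinuousMap.id X) x₀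
    (⟨x₀, (1 : H)⟩ : Z.TotalSpace) rfl
  have hF' : ∀ x, (F x).proj = x := fun x => congrFun hF x
  let c : J → X → H := fun i x => ((Z.localTriv i) (F x)).2
  have hc : ∀ i x, c i x = Z.coordChange (Z.indexAt (F x).proj) i (F x).proj (F x).2 :=
    fun i x => rfl
  have hcont : ∀ i, ContinuousOn (c i) (V i) := fun i => by
    refine continuous_snd.comp_continuousOn
      ((Z.localTriv i).continuousOn.comp F.continuous.continuousOn fun x hx => ?_)
    rw [Z.mem_localTriv_source, hF']
    exact hx
  have hconst : ∀ i, ∀ x ∈ V i, ∀ y ∈ V i, c i x = c i y := fun i x hx y hy =>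
    (hconn i).constant (Y := H) (f := c i) (hcont i) hx hy
  have hchange : ∀ i j x, x ∈ V i → x ∈ V j → c j x = c i x * g i j := fun i j x hi hj => by
    have h := Z.coordChange_comp (Z.indexAt (F x).proj) i j (F x).proj
      ⟨⟨Z.mem_baseSet_at _, by rw [hF']; exact hi⟩, by rw [hF']; exact hj⟩ (F x).2
    exact h.symm
  refine ⟨fun i => if h : (V i).Nonempty then c i h.some else 1, fun i j ⟨x, hi, hj⟩ => ?_⟩
  have hi' : (V i).Nonempty := ⟨x, hi⟩
  have hj' : (V j).Nonempty := ⟨x, hj⟩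
  simp only [dif_pos hi', dif_pos hj']
  rw [hconst j _ hj'.some_mem x hj, hconst i _ hi'.some_mem x hi, hchange i j x hi hj]

/-- The nerve of an open cover of a preconnected space by nonempty sets is connected. -/
theorem eq_of_nerve_connected {X J α : Type*} [TopologicalSpace X] [PreconnectedSpace X]
    (V : J → Set X) (hopen : ∀ j, IsOpen (V j)) (hne : ∀ j, (V j).Nonempty)
    (hcov : ∀ x, ∃ j, x ∈ V j) (c : J → α)
    (hc : ∀ i j, (V i ∩ V j).Nonempty → c i = c j) (i j : J) : c i = c j := by
  choose idx hidx using hcov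
  have hloc : IsLocallyConstant fun x => c (idx x) := by
    rw [IsLocallyConstant.iff_exists_open]
    exact fun x => ⟨V (idx x), hopen _, hidx x, fun y hy => hc _ _ ⟨y, hidx y, hy⟩⟩
  obtain ⟨x, hx⟩ := hne i
  obtain ⟨y, hy⟩ := hne j
  rw [hc i (idx x) ⟨x, hx, hidx x⟩, hc j (idx y) ⟨y, hy, hidx y⟩]
  exact hloc.apply_eq_of_preconnectedSpace x y

/-- A finite presentation of `Γ` by relations `a * b = ab` of length three: `S₀` generates, and
a map that is multiplicative as far as it can be seen on `S` agrees on `S₀` with a homomorphism. -/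
structure TriangularPresentation (Γ : Type) [Group Γ] where
  S₀ : Set Γ
  S : Set Γ
  finite : S.Finite
  closure_eq : Subgroup.closure S₀ = ⊤
  exists_hom : ∀ (H : Type) [Group H] (f : Γ → H),
    (∀ a ∈ S, ∀ b ∈ S, a * b ∈ S → f (a * b) = f a * f b) → ∃ F : Γ →* H, ∀ a ∈ S₀, F a = f a

/-- A group acting with finitely many orbits on the sets of an open cover of a simply connected
space by preconnected sets, so that each set meets finitely many others, is finitely presented. -/
theorem nonempty_triangularPresentation {X I Γ : Type} [TopologicalSpace X]
    [SimplyConnectedSpace X] [LocallyPathConnectedSpace X] [Group Γ] [Finite I]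
    (V : Γ × I → Set X) (hopen : ∀ j, IsOpen (V j))
    (hconn : ∀ j, IsPreconnected (V j)) (hne : ∀ j, (V j).Nonempty) (hcov : ∀ x, ∃ j, x ∈ V j)
    (hinv : ∀ (c a b : Γ) (i j : I),
      (V (a, i) ∩ V (b, j)).Nonempty → (V (c * a, i) ∩ V (c * b, j)).Nonempty)
    (hfin : ∀ i j, {a | (V (1, i) ∩ V (a, j)).Nonempty}.Finite) :
    Nonempty (TriangularPresentation Γ) := by
  classical
  set S₀ : Set Γ := ⋃ i, ⋃ j, {a | (V (1, i) ∩ V (a, j)).Nonempty} with hS₀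
  have hS₀fin : S₀.Finite := Set.finite_iUnion fun i => Set.finite_iUnion fun j => hfin i j
  have hmem : ∀ s t : Γ × I, (V s ∩ V t).Nonempty → s.1⁻¹ * t.1 ∈ S₀ := fun s t h => by
    have := hinv s.1⁻¹ s.1 t.1 s.2 t.2 h
    rw [inv_mul_cancel] at this
    exact Set.mem_iUnion₂.mpr ⟨s.2, t.2, this⟩
  obtain ⟨x₀⟩ : Nonempty X := inferInstance
  obtain ⟨⟨a₀, i₀⟩, -⟩ := hcov x₀
  -- `W` records the group elements along a chain of overlapping sets from `(1, i₀)` to `s`, so that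
  -- `ψ s = f s.1` propagates along it. It depends on neither `H` nor `f`. Adding `W (1, i)` to `S`
  -- for every `i` forces the trivialization to be `1` at every `(1, i)`.
  have hchain : ∀ s, ∃ W : Set Γ, W.Finite ∧ 1 ∈ W ∧ ∀ (H : Type) [Group H] (f : Γ → H),
      (∀ a ∈ S₀ ∪ W, ∀ b ∈ S₀ ∪ W, a * b ∈ S₀ ∪ W → f (a * b) = f a * f b) →
      ∀ ψ : Γ × I → H, ψ (1, i₀) = 1 →
      (∀ s t, (V s ∩ V t).Nonempty → ψ t = ψ s * f (s.1⁻¹ * t.1)) → ψ s = f s.1 := by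
    intro s
    have hs : Relation.ReflTransGen (fun s t => (V s ∩ V t).Nonempty) (1, i₀) s := by
      have := eq_of_nerve_connected V hopen hne hcov
        (fun s => Relation.ReflTransGen (fun s t => (V s ∩ V t).Nonempty) (1, i₀) s)
        (fun i j hij => propext ⟨fun h => h.tail hij,
          fun h => h.tail (by rwa [Set.inter_comm])⟩) (1, i₀) s
      exact this.mp .refl
    induction hs with
    | refl =>
      refine ⟨{1}, Set.finite_singleton _, rfl, fun H _ f hf ψ hψ _ => ?_⟩
      have h1 := hf 1 (.inr rfl) 1 (.inr rfl) (by simp)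
      rw [mul_one] at h1
      rw [hψ, left_eq_mul.mp h1]
    | @tail s t _ hst ih =>
      obtain ⟨W, hW, h1, ih⟩ := ih
      refine ⟨insert s.1 (insert t.1 W), (hW.insert _).insert _, by simp [h1],
        fun H _ f hf ψ hψ₀ hψ => ?_⟩
      have hs : ψ s = f s.1 := ih H f (fun a ha b hb hab => hf a
        (Set.union_subset_union_right _ (fun _ h => .inr (.inr h)) ha) b
        (Set.union_subset_union_right _ (fun _ h => .inr (.inr h)) hb)
        (Set.union_subset_union_right _ (fun _ h => .inr (.inr h)) hab)) ψ hψ₀ hψ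
      have := hf s.1 (.inr (.inl rfl)) (s.1⁻¹ * t.1) (.inl (hmem s t hst))
        (by rw [mul_inv_cancel_left]; exact .inr (.inr (.inl rfl)))
      rw [mul_inv_cancel_left] at this
      rw [hψ s t hst, hs, this]
  choose W hWfin hW1 hW using hchain
  set S : Set Γ := S₀ ∪ ⋃ i, W (1, i)
  refine ⟨⟨S₀, S, hS₀fin.union (Set.finite_iUnion fun i => hWfin _),
    ?_, fun H _ f hf => ?_⟩⟩
  · refine eq_top_iff.mpr fun a _ => ?_
    have := eq_of_nerve_connected V hopen hne hcov
      (fun s => (QuotientGroup.mk s.1 : Γ ⧸ Subgroup.closure S₀))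
      (fun s t h => QuotientGroup.eq.mpr (Subgroup.subset_closure (hmem s t h))) (1, i₀) (a, i₀)
    simpa using QuotientGroup.eq.mp this
  · obtain ⟨ψ, hψ⟩ := exists_cech_trivialization V hopen hconn hcov
      (fun s t => f (s.1⁻¹ * t.1)) (fun i j k ⟨x, ⟨hi, hj⟩, hk⟩ => by
        rw [← hf]
        · group
        · exact .inl (hmem i j ⟨x, hi, hj⟩)
        · exact .inl (hmem j k ⟨x, hj, hk⟩)
        · have := hmem i k ⟨x, hi, hk⟩
          rw [mul_assoc, mul_inv_cancel_left]
          exact .inl this)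
    set φ : Γ × I → H := fun s => (ψ (1, i₀))⁻¹ * ψ s with hφ
    have hφ₀ : φ (1, i₀) = 1 := inv_mul_cancel _
    have hφ' : ∀ s t, (V s ∩ V t).Nonempty → φ t = φ s * f (s.1⁻¹ * t.1) := fun s t h => by
      simp only [hφ, hψ s t h, mul_assoc]
    have hf1 : f 1 = 1 := by
      have h1 : (1 : Γ) ∈ S := .inr (Set.mem_iUnion.mpr ⟨i₀, hW1 _⟩)
      have := hf 1 h1 1 h1 (by simpa using h1)
      rw [mul_one] at this
      exact left_eq_mul.mp this
    have hφ1 : ∀ i, φ (1, i) = 1 := fun i => by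
      have hsub : S₀ ∪ W (1, i) ⊆ S :=
        Set.union_subset_union_right _ (Set.subset_iUnion (fun i => W (1, i)) i)
      rw [hW (1, i) H f (fun a ha b hb hab => hf a (hsub ha) b (hsub hb) (hsub hab)) φ hφ₀ hφ',
        hf1]
    -- Translation by `a` preserves `s⁻¹ t`, so this ratio agrees on overlapping sets and hence
    -- everywhere. Its common value is the homomorphism at `a`.
    have hequi : ∀ (a : Γ) (s t : Γ × I),
        φ (a * s.1, s.2) * (φ s)⁻¹ = φ (a * t.1, t.2) * (φ t)⁻¹ := fun a =>
      eq_of_nerve_connected V hopen hne hcov (fun s => φ (a * s.1, s.2) * (φ s)⁻¹) fun s t h => by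
        have h' := hφ' _ _ (hinv a s.1 t.1 s.2 t.2 h)
        have e : (a * s.1)⁻¹ * (a * t.1) = s.1⁻¹ * t.1 := by group
        dsimp only at h' ⊢
        rw [h', hφ' s t h, e]
        group
    refine ⟨MonoidHom.mk' (fun a => φ (a, i₀)) fun a b => ?_, fun a ha => ?_⟩
    · have := hequi a (b, i₀) (1, i₀)
      simp only [mul_one, hφ₀, inv_one] at this
      rw [← this]
      group
    · obtain ⟨i, j, hij⟩ := Set.mem_iUnion₂.mp ha
      have h1 := hφ' _ _ hij
      simp only [hφ1, inv_one, one_mul] at h1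
      have h2 := hequi a (1, i₀) (1, j)
      simp only [mul_one, hφ1, inv_one] at h2
      rw [MonoidHom.mk'_apply, h2, h1]

/-! ### Torsion in cokernels of integer matrices -/

/-- A rational matrix has an invertible square submatrix whose rows detect its kernel. -/
theorem Matrix.exists_submatrix_det_ne_zero {κ ι : Type} [Fintype κ] [Fintype ι]
    (A : Matrix κ ι ℚ) :
    ∃ (r : ℕ) (a : Fin r → κ) (b : Fin r → ι), r ≤ Fintype.card ι ∧ (A.submatrix a b).det ≠ 0 ∧
      ∀ y, (∀ i, (A.mulVec y) (a i) = 0) → A.mulVec y = 0 := by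
  classical
  -- First a basis of the row space among the rows, then a basis of the column space of the selected
  -- rows; both have as many elements as the rank.
  obtain ⟨κ', a, ha, haspan, halin⟩ := exists_linearIndependent' ℚ A.row
  have : Finite κ' := Finite.of_injective a ha
  have : Fintype κ' := Fintype.ofFinite κ'
  set A₁ : Matrix κ' ι ℚ := A.submatrix a id
  have hr : A₁.rank = Fintype.card κ' := LinearIndependent.rank_matrix (M := A₁) halin
  obtain ⟨ι', b, hb, hbspan, hblin⟩ := exists_linearIndependent' ℚ A₁.col
  have : Finite ι' := Finite.of_injective b hb
  have : Fintype ι' := Fintype.ofFinite ι'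
  have hcard : Fintype.card ι' = Fintype.card κ' := by
    rw [← finrank_span_eq_card hblin, hbspan, ← hr, Matrix.rank_eq_finrank_span_cols]
  let e : Fin (Fintype.card κ') ≃ κ' := (Fintype.equivFin κ').symm
  let e' : Fin (Fintype.card κ') ≃ ι' := (Fintype.equivFinOfCardEq hcard).symm
  refine ⟨Fintype.card κ', a ∘ e, b ∘ e', ?_, ?_, fun y hy => ?_⟩
  · rw [← hcard]
    exact Fintype.card_le_of_injective b hb
  · have h1 : LinearIndependent ℚ (fun j => (A₁.col (b (e' j)))) := hblin.comp _ e'.injective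
    have h2 : LinearIndependent ℚ (A.submatrix (a ∘ e) (b ∘ e')).col :=
      h1.map' (LinearMap.funLeft ℚ ℚ e)
        (LinearMap.ker_eq_bot.mpr (LinearMap.funLeft_injective_of_surjective _ _ _ e.surjective))
    rw [Matrix.linearIndependent_cols_iff_isUnit, Matrix.isUnit_iff_isUnit_det] at h2
    exact h2.ne_zero
  · have hle : Submodule.span ℚ (Set.range A.row) ≤
        LinearMap.ker (dotProductBilin ℚ ℚ |>.flip y) := by
      rw [← haspan, Submodule.span_le]
      rintro _ ⟨i, rfl⟩
      have := hy (e.symm i)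
      rw [Function.comp_apply, Equiv.apply_symm_apply] at this
      exact this
    ext i
    exact hle (Submodule.subset_span ⟨i, rfl⟩)

/-- The torsion of the cokernel of an integral matrix is bounded by any bound for its minors. -/
theorem card_le_of_torsion_coker {κ ι T M₁ M₂ : Type} [Finite κ] [Fintype ι]
    [AddCommGroup M₁] [AddCommGroup M₂] [m₁ : Module ℤ M₁] [m₂ : Module ℤ M₂]
    (b₁ : Module.Basis ι ℤ M₁) (b₂ : Module.Basis κ ℤ M₂)
    (L₀ : M₁ →+ M₂) (B : ℕ) (hB1 : 1 ≤ B) (hB : ∀ i j, |b₂.repr (L₀ (b₁ j)) i| ≤ B)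
    (f : T → M₂) (hf : ∀ t, ∃ n : ℤ, n ≠ 0 ∧ ∃ x, L₀ x = n • f t)
    (hsep : ∀ s t, (∃ x, L₀ x = f s - f t) → s = t) :
    Finite T ∧ Nat.card T ≤ (Fintype.card ι).factorial * B ^ Fintype.card ι := by
  classical
  have : Fintype κ := Fintype.ofFinite κ
  let L : M₁ →ₗ[ℤ] M₂ := { L₀ with map_smul' := fun n x => by simpa using map_intCast_smul L₀ ℤ ℤ n x }
  replace hB : ∀ i j, |b₂.repr (L (b₁ j)) i| ≤ B := hB
  replace hf : ∀ t, ∃ n : ℤ, n ≠ 0 ∧ ∃ x, L x = n • f t := hf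
  replace hsep : ∀ s t, (∃ x, L x = f s - f t) → s = t := hsep
  clear_value L
  set A : Matrix κ ι ℤ := LinearMap.toMatrix b₁ b₂ L with hA
  obtain ⟨r, a, b, hr, hdet, hker⟩ := (A.map ((↑) : ℤ → ℚ)).exists_submatrix_det_ne_zero
  set A' : Matrix (Fin r) (Fin r) ℤ := A.submatrix a b with hA'
  have hdet' : A'.det ≠ 0 := by
    intro h
    apply hdet
    have : (A.map ((↑) : ℤ → ℚ)).submatrix a b = (Int.castRingHom ℚ).mapMatrix A' := rfl
    rw [this, ← RingHom.map_det, h, map_zero]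
  have hrepr : ∀ x, ⇑(b₂.repr (L x)) = A.mulVec (b₁.repr x) := fun x =>
    (LinearMap.toMatrix_mulVec_repr b₁ b₂ L x).symm
  have hker' : ∀ x, (∀ i, b₂.repr (L x) (a i) = 0) → L x = 0 := fun x hx => by
    have h := hker (fun j => (b₁.repr x j : ℚ)) (fun i => by
      have h := congrArg (Int.cast : ℤ → ℚ) (hx i)
      rw [hrepr] at h
      simpa [Matrix.mulVec, dotProduct] using h)
    apply b₂.ext_elem
    intro i
    have h := congrFun h i
    rw [hrepr]
    simp only [Matrix.mulVec, dotProduct, Matrix.map_apply, Pi.zero_apply] at h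
    simp only [Matrix.mulVec, dotProduct, map_zero, Finsupp.coe_zero, Pi.zero_apply]
    exact_mod_cast h
  have hinj : Function.Injective A'.mulVecLin := by
    rw [← LinearMap.ker_eq_bot, Matrix.ker_mulVecLin_eq_bot_iff]
    intro v hv
    exact Matrix.eq_zero_of_mulVec_eq_zero hdet' hv
  have hcard := Submodule.natAbs_det_equiv (LinearMap.range A'.mulVecLin)
    (LinearEquiv.ofInjective A'.mulVecLin hinj)
  have hcomp : ((LinearMap.range A'.mulVecLin).subtype ∘ₗ AddMonoidHom.toIntLinearMap
      ((LinearEquiv.ofInjective A'.mulVecLin hinj : (Fin r → ℤ) →+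
        LinearMap.range A'.mulVecLin))) = Matrix.toLin' A' := by
    ext; rfl
  rw [hcomp, LinearMap.det_toLin'] at hcard
  have hfin : Finite ((Fin r → ℤ) ⧸ LinearMap.range A'.mulVecLin) :=
    Nat.finite_of_card_ne_zero (by rw [← hcard]; simpa using hdet')
  -- The target has `|det A'|` elements. Reading off only the selected rows loses nothing, as
  -- `hker'` recovers the other rows.
  let g : T → (Fin r → ℤ) ⧸ LinearMap.range A'.mulVecLin :=
    fun t => Submodule.Quotient.mk fun i => b₂.repr (f t) (a i)
  have hg : Function.Injective g := by
    intro s t hst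
    obtain ⟨y, hy⟩ := (Submodule.Quotient.eq _).mp hst
    obtain ⟨n, hn, u, hu⟩ := hf s
    obtain ⟨k, hk, v, hv⟩ := hf t
    set x : M₁ := ∑ j, y j • b₁ (b j) with hx
    have hxr : ∀ i, b₂.repr (L x) (a i) = b₂.repr (f s - f t) (a i) := fun i => by
      have h := congrFun hy i
      simp only [Matrix.mulVecLin_apply, Matrix.mulVec, dotProduct, Pi.sub_apply, hA',
        Matrix.submatrix_apply, hA, LinearMap.toMatrix_apply] at h
      simp only [hx, map_sum, map_zsmul, Finsupp.coe_finsetSum, Finset.sum_apply, map_sub,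
        Finsupp.coe_sub, Pi.sub_apply, Finsupp.coe_smul, Pi.smul_apply, smul_eq_mul, ← h]
      exact Finset.sum_congr rfl fun j _ => mul_comm _ _
    refine hsep s t ⟨x, ?_⟩
    -- Multiplying by `n * k` puts the whole discrepancy into the image of `L`, where vanishing on
    -- the selected rows implies vanishing.
    have hz : L ((n * k) • x - (k • u - n • v)) = (n * k) • (L x - (f s - f t)) := by
      rw [zsmul_sub, zsmul_sub, map_sub, map_sub, map_zsmul, map_zsmul, map_zsmul, hu, hv,
        ← mul_zsmul', ← mul_zsmul]
    have h0 := hker' ((n * k) • x - (k • u - n • v)) fun i => by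
      rw [hz, map_zsmul, map_sub]
      simp [hxr]
    refine b₂.ext_elem fun i => sub_eq_zero.mp ?_
    have h := congrArg (b₂.repr · i) (hz.symm.trans h0)
    simp only [map_zsmul, map_sub, map_zero, Finsupp.coe_smul, Pi.smul_apply, smul_eq_mul,
      Finsupp.coe_zero, Pi.zero_apply, mul_eq_zero, hn, hk, false_or, Finsupp.coe_sub,
      Pi.sub_apply] at h
    simpa only [map_sub, Finsupp.coe_sub, Pi.sub_apply] using h
  refine ⟨Finite.of_injective g hg, (Nat.card_le_card_of_injective g hg).trans ?_⟩
  rw [← hcard]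
  have hle := Matrix.det_le (A := A') (abv := (AbsoluteValue.abs : AbsoluteValue ℤ ℤ))
    (x := (B : ℤ)) (fun i j => by
      simpa [hA', hA, LinearMap.toMatrix_apply] using hB (a i) (b j))
  simp only [AbsoluteValue.abs_apply, Fintype.card_fin, nsmul_eq_mul] at hle
  have hle' : A'.det.natAbs ≤ r.factorial * B ^ r := by
    zify
    exact hle
  exact hle'.trans (Nat.mul_le_mul (Nat.factorial_le hr) (Nat.pow_le_pow_right hB1 hr))

/-! ### Second cohomology through a presentation -/

/-- The affine permutation `m ↦ ρ a m + x`. -/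
def Representation.affinePerm {G M : Type} [Group G] [AddCommGroup M] [Module ℤ M]
    (ρ : Representation ℤ G M) (a : G) (x : M) : Equiv.Perm M where
  toFun m := ρ a m + x
  invFun m := ρ a⁻¹ (m - x)
  left_inv m := by simp
  right_inv m := by simp

namespace TriangularPresentation

variable {G : Type} [Group G] (P : TriangularPresentation G)

/-- A cochain satisfying the cocycle relations visible in the presentation agrees on the generators
with a cocycle. -/
theorem exists_cocycle {M : Type} [AddCommGroup M] [Module ℤ M] (ρ : Representation ℤ G M)
    (β : G → M) (hβ : ∀ a ∈ P.S, ∀ b ∈ P.S, a * b ∈ P.S → β (a * b) = ρ a (β b) + β a) :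
    ∃ c : G → M, (∀ a b, c (a * b) = ρ a (c b) + c a) ∧ ∀ a ∈ P.S₀, c a = β a := by
  -- Crossed homomorphisms are homomorphisms into affine permutations with linear part `ρ`; the
  -- cocycle is then the image of `0`.
  obtain ⟨F, hF⟩ := P.exists_hom (Equiv.Perm M) (fun a => ρ.affinePerm a (β a))
    fun a ha b hb hab => by
      ext m
      simp [Representation.affinePerm, hβ a ha b hb hab, add_assoc]
  have key : ∀ a m, F a m = ρ a m + F a 0 := fun a => by
    have ha : a ∈ Subgroup.closure P.S₀ := by rw [P.closure_eq]; trivial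
    induction ha using Subgroup.closure_induction with
    | mem a ha => intro m; simp [hF a ha, Representation.affinePerm]
    | one => simp
    | mul a b _ _ iha ihb =>
      intro m
      rw [map_mul, Equiv.Perm.mul_apply, Equiv.Perm.mul_apply, ihb m, iha, iha (F b 0)]
      simp [add_assoc]
    | inv a _ iha =>
      intro m
      rw [map_inv, Equiv.Perm.inv_eq_iff_eq, iha, map_add, Representation.self_inv_apply,
        add_assoc, ← iha, Equiv.Perm.inv_def, Equiv.apply_symm_apply, add_zero]
  refine ⟨fun a => F a 0, fun a b => ?_, fun a ha => ?_⟩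
  · simp only [map_mul, Equiv.Perm.mul_apply]
    exact key a _
  · simp [hF a ha, Representation.affinePerm]

/-- A `2`-cocycle with torsion class whose restriction to the relations of the presentation is a
coboundary is a coboundary. -/
theorem exists_primitive {M : Type} [AddCommGroup M] [Module ℤ M]
    (htf : ∀ (n : ℤ) (x : M), n ≠ 0 → n • x = 0 → x = 0) (ρ : Representation ℤ G M)
    (α : G → G → M) (n : ℤ) (hn : n ≠ 0) (β : G → M)
    (hβ : ∀ a b, n • α a b = ρ a (β b) - β (a * b) + β a) (y : G → M)
    (hy : ∀ a ∈ P.S, ∀ b ∈ P.S, a * b ∈ P.S → α a b = ρ a (y b) - y (a * b) + y a) :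
    ∃ γ : G → M, ∀ a b, α a b = ρ a (γ b) - γ (a * b) + γ a := by
  -- On `S` both `β` and `n • y` have coboundary `n • α`, so their difference satisfies the visible
  -- cocycle relations.
  obtain ⟨c, hc, hcS⟩ := P.exists_cocycle ρ (fun a => β a - n • y a) fun a ha b hb hab => by
    have h1 := hβ a b
    rw [hy a ha b hb hab] at h1
    have h2 : β (a * b) = ρ a (β b) + β a - n • (ρ a (y b) - y (a * b) + y a) := by
      rw [h1]; abel
    rw [h2, map_sub, map_zsmul, zsmul_add, zsmul_sub]
    abel
  set δ : G → M := fun a => β a - n • y a - c a with hδ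
  have hδmul : ∀ a b, δ (a * b) =
      ρ a (δ b) + δ a - n • (α a b - (ρ a (y b) - y (a * b) + y a)) := fun a b => by
    simp only [hδ, hc, map_sub, map_zsmul, zsmul_add, zsmul_sub, hβ]
    abel
  -- Modulo `n`, `δ` is a crossed homomorphism vanishing on the generators, hence it vanishes.
  -- Dividing by `n` gives `z`, and `z + y` is the required primitive because `M` has no torsion.
  have hdiv : ∀ a, ∃ x, δ a = n • x := fun a => by
    have ha : a ∈ Subgroup.closure P.S₀ := by rw [P.closure_eq]; trivial
    have hone : ∃ x, δ 1 = n • x := by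
      have h := hδmul 1 1
      rw [mul_one, map_one, Module.End.one_apply, add_sub_assoc, left_eq_add, sub_eq_zero] at h
      exact ⟨_, h⟩
    induction ha using Subgroup.closure_induction with
    | mem a ha => exact ⟨0, by rw [zsmul_zero]; simp [hδ, hcS a ha]⟩
    | one => exact hone
    | mul a b _ _ iha ihb =>
      obtain ⟨u, hu⟩ := iha
      obtain ⟨v, hv⟩ := ihb
      exact ⟨ρ a v + u - (α a b - (ρ a (y b) - y (a * b) + y a)), by
        rw [hδmul, hu, hv, map_zsmul, zsmul_sub (ρ a v + u), zsmul_add]⟩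
    | inv a _ iha =>
      obtain ⟨u, hu⟩ := iha
      obtain ⟨v, hv⟩ := hone
      have h := hδmul a⁻¹ a
      rw [inv_mul_cancel, hu, hv, map_zsmul] at h
      refine ⟨v - ρ a⁻¹ u + (α a⁻¹ a - (ρ a⁻¹ (y a) - y 1 + y a⁻¹)), ?_⟩
      rw [zsmul_add, zsmul_sub v, h]
      abel
  choose z hz using hdiv
  refine ⟨fun a => z a + y a, fun a b => sub_eq_zero.mp (htf n _ hn ?_)⟩
  have h := hδmul a b
  rw [hz, hz, hz, map_zsmul] at h
  simp only [map_add, zsmul_sub, zsmul_add] at h ⊢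
  rw [h]
  abel

/-- The coboundary from `1`-cochains on `S` to `2`-cochains on the relations. -/
def differential {M : Type} [AddCommGroup M] [Module ℤ M] (ρ : Representation ℤ G M) :
    (P.S → M) →+ ({t : P.S × P.S // (t.1 * t.2 : G) ∈ P.S} → M) where
  toFun x t := ρ t.1.1 (x t.1.2) - x ⟨t.1.1 * t.1.2, t.2⟩ + x t.1.1
  map_add' x y := by ext; simp only [Pi.add_apply, map_add]; abel
  map_zero' := by ext; simp

/-- The cokernel bound is applied to `P.differential ρ`: torsion gives a multiple in its image, and
`exists_primitive` gives injectivity. Each entry is at most `B + 2`: `B` from the action and `1`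
from each of the other two terms. -/
theorem card_torsion_H2_le [Fintype P.S] {M : Type} [AddCommGroup M] [mod : Module ℤ M]
    (ρ : Representation ℤ G M) {ι : Type} [Fintype ι] (b : Module.Basis ι ℤ M) (B : ℕ)
    (hB : ∀ a ∈ P.S, ∀ i j, |b.repr (ρ a (b j)) i| ≤ B) :
    Finite (AddCommGroup.torsion (groupCohomology (Rep.of ρ) 2)) ∧
    Nat.card (AddCommGroup.torsion (groupCohomology (Rep.of ρ) 2)) ≤
      (Fintype.card P.S * Fintype.card ι).factorial *
        (B + 2) ^ (Fintype.card P.S * Fintype.card ι) := by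
  classical
  have hlift : ∀ t : AddCommGroup.torsion (groupCohomology (Rep.of ρ) 2),
      ∃ α : groupCohomology.cocycles₂ (Rep.of ρ), groupCohomology.H2π (Rep.of ρ) α = t.1 := fun t =>
    groupCohomology.H2_induction_on (C := fun x => ∃ α, groupCohomology.H2π (Rep.of ρ) α = x) t.1
      fun α => ⟨α, rfl⟩
  choose lift hlift using hlift
  have htf : ∀ (n : ℤ) (x : M), n ≠ 0 → n • x = 0 → x = 0 := fun n x hn hx => by
    refine b.ext_elem fun i => ?_
    have := congrArg (b.repr · i) hx
    simpa [hn] using this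
  have htor : ∀ x ∈ AddCommGroup.torsion (groupCohomology (Rep.of ρ) 2), ∀ α : groupCohomology.cocycles₂ (Rep.of ρ),
      groupCohomology.H2π (Rep.of ρ) α = x → ∃ n : ℤ, n ≠ 0 ∧ ∃ β : G → M,
        ∀ a c, n • α (a, c) = ρ a (β c) - β (a * c) + β a := fun x hx α hα => by
    obtain ⟨n, hn, h0⟩ := isOfFinAddOrder_iff_nsmul_eq_zero.mp hx
    refine ⟨n, by omega, ?_⟩
    have h : groupCohomology.H2π (Rep.of ρ) (n • α) = 0 := by
      rw [map_nsmul, hα, h0]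
    obtain ⟨β, hβ⟩ := (groupCohomology.H2π_eq_zero_iff _).mp h
    refine ⟨β, fun a c => ?_⟩
    have := congrFun hβ (a, c)
    rw [groupCohomology.d₁₂_hom_apply] at this
    rw [this, natCast_zsmul]
    rfl
  have hmain := card_le_of_torsion_coker (m₁ := _) (m₂ := _) (ι := Σ _ : P.S, ι)
    (κ := Σ _ : {t : P.S × P.S // (t.1 * t.2 : G) ∈ P.S}, ι)
    (T := AddCommGroup.torsion (groupCohomology (Rep.of ρ) 2)) (Pi.basis fun _ => b) (Pi.basis fun _ => b)
    (P.differential ρ) (B + 2) (by omega) (fun i j => ?_) (fun x t => lift x (t.1.1, t.1.2))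
    (fun x => ?_) (fun x y hxy => ?_)
  · simpa using hmain
  · rw [Pi.basis_apply, Pi.basis_repr]
    have h1 : |b.repr (ρ i.1.1.1 ((Pi.single j.1 (b j.2) : P.S → M) i.1.1.2)) i.2| ≤ B := by
      rcases eq_or_ne i.1.1.2 j.1 with h | h
      · rw [h, Pi.single_eq_same]
        exact hB _ i.1.1.1.2 _ _
      · rw [Pi.single_eq_of_ne h]
        simp
    have h2 : ∀ s : P.S, |b.repr ((Pi.single j.1 (b j.2) : P.S → M) s) i.2| ≤ 1 := fun s => by
      rcases eq_or_ne s j.1 with h | h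
      · rw [h, Pi.single_eq_same, b.repr_self, Finsupp.single_apply]
        split_ifs <;> simp
      · rw [Pi.single_eq_of_ne h]
        simp
    have h3 := h2 ⟨_, i.1.2⟩
    have h4 := h2 i.1.1.1
    simp only [differential, AddMonoidHom.coe_mk, ZeroHom.coe_mk, map_add, map_sub, Finsupp.coe_add,
      Finsupp.coe_sub, Pi.add_apply, Pi.sub_apply, Nat.cast_add, Nat.cast_ofNat]
    rw [abs_le] at *
    constructor <;> linarith
  · obtain ⟨n, hn, β, hβ⟩ := htor x.1 x.2 (lift x) (hlift x)
    refine ⟨n, hn, fun s => β s, ?_⟩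
    ext t
    exact (hβ _ _).symm
  · obtain ⟨u, hu⟩ := hxy
    obtain ⟨n, hn, β, hβ⟩ := htor (x - y).1 (x - y).2 (lift x - lift y) (by
      rw [map_sub, hlift, hlift]; rfl)
    obtain ⟨γ, hγ⟩ := P.exists_primitive htf ρ (fun a c => (lift x - lift y) (a, c)) n hn β hβ
      (fun a => if h : a ∈ P.S then u ⟨a, h⟩ else 0) fun a ha c hc hac => by
        have := congrFun hu ⟨(⟨a, ha⟩, ⟨c, hc⟩), hac⟩
        rw [dif_pos ha, dif_pos hc, dif_pos hac]
        exact this.symm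
    refine Subtype.ext ?_
    rw [← hlift, ← hlift, groupCohomology.H2π_eq_iff]
    refine ⟨γ, ?_⟩
    ext ⟨a, c⟩
    rw [groupCohomology.d₁₂_hom_apply]
    exact (hγ a c).symm

end TriangularPresentation

/-! ### Growth of the matrices on symmetric powers -/

/-- A ring that is finite free over `ℤ` has a submultiplicative norm bounding the coordinates. -/
theorem Module.Basis.exists_submultiplicative_bound {R κ : Type} [CommRing R] [Fintype κ]
    (b : Module.Basis κ ℤ R) :
    ∃ μ : R → ℕ, μ 0 = 0 ∧ (∀ x y, μ (x + y) ≤ μ x + μ y) ∧ (∀ x y, μ (x * y) ≤ μ x * μ y) ∧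
      ∀ x k, (b.repr x k).natAbs ≤ μ x := by
  set ν : R → ℕ := fun x => ∑ k, (b.repr x k).natAbs with hν
  have hadd : ∀ x y, ν (x + y) ≤ ν x + ν y := fun x y => by
    simp only [hν, map_add, Finsupp.add_apply, ← Finset.sum_add_distrib]
    exact Finset.sum_le_sum fun k _ => Int.natAbs_add_le _ _
  have h0 : ν 0 = 0 := by simp [hν]
  have hsmul : ∀ (n : ℤ) x, ν (n • x) = n.natAbs * ν x := fun n x => by
    simp only [hν, map_zsmul, Finsupp.smul_apply, smul_eq_mul, Int.natAbs_mul, Finset.mul_sum]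
  have hsum : ∀ f : κ → R, ν (∑ k, f k) ≤ ∑ k, ν (f k) := fun f =>
    Finset.le_sum_of_subadditive ν h0.le hadd _ _
  -- `C` bounds the structure constants, which makes `C * ν` submultiplicative; the summand `1`
  -- ensures that it still dominates the coordinates.
  set C : ℕ := 1 + ∑ k, ∑ l, ν (b k * b l) with hC
  have hbC : ∀ k l, ν (b k * b l) ≤ C := fun k l =>
    ((Finset.single_le_sum (f := fun l => ν (b k * b l)) (fun _ _ => Nat.zero_le _)
      (Finset.mem_univ l)).trans (Finset.single_le_sum (f := fun k => ∑ l, ν (b k * b l))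
        (fun _ _ => Nat.zero_le _) (Finset.mem_univ k))).trans (Nat.le_add_left _ _)
  have hmul : ∀ x y, ν (x * y) ≤ C * (ν x * ν y) := fun x y => by
    have hx : x * y = ∑ k, ∑ l, (b.repr x k * b.repr y l) • (b k * b l) := by
      conv_lhs => rw [← b.sum_repr x, ← b.sum_repr y, Finset.sum_mul_sum]
      simp only [smul_mul_smul_comm]
    calc ν (x * y) ≤ ∑ k, ∑ l, (b.repr x k).natAbs * (b.repr y l).natAbs * C := by
          rw [hx]
          refine (hsum _).trans (Finset.sum_le_sum fun k _ => (hsum _).trans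
            (Finset.sum_le_sum fun l _ => ?_))
          rw [hsmul, Int.natAbs_mul]
          exact Nat.mul_le_mul le_rfl (hbC k l)
      _ = C * (ν x * ν y) := by
          rw [mul_comm C, show ν x * ν y = _ from Finset.sum_mul_sum _ _ _ _]
          simp only [Finset.sum_mul]
  refine ⟨fun x => C * ν x, by simp [h0], fun x y => ?_, fun x y => ?_, fun x k => ?_⟩
  · rw [← mul_add]
    exact Nat.mul_le_mul le_rfl (hadd x y)
  · rw [mul_mul_mul_comm, mul_assoc C C]
    exact Nat.mul_le_mul le_rfl ((hmul x y))
  · exact (Finset.single_le_sum (f := fun k => (b.repr x k).natAbs) (fun _ _ => Nat.zero_le _)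
      (Finset.mem_univ k)).trans (Nat.le_mul_of_pos_left _ (by omega))

namespace SymPow

variable {R : Type} [CommRing R]

/-- The exponent of the monomial `X^i Y^(m-i)`. -/
noncomputable def expo (m : ℕ) (i : Fin (m + 1)) : Fin 2 →₀ ℕ :=
  Finsupp.single 0 (i : ℕ) + Finsupp.single 1 (m - i)

theorem expo_injective (m : ℕ) : Function.Injective (expo m) := fun i j h => by
  have := DFunLike.congr_fun h 0
  simpa [expo, Fin.ext_iff] using this

theorem exists_expo_eq {m : ℕ} {d : Fin 2 →₀ ℕ} (hd : d.degree = m) : ∃ i, expo m i = d := by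
  have h : d 0 + d 1 = m := by rw [← hd, Finsupp.degree_eq_sum, Fin.sum_univ_two]
  refine ⟨⟨d 0, by omega⟩, ?_⟩
  ext j
  fin_cases j <;> simp [expo]
  omega

/-- A homogeneous polynomial of degree `m` is given by its `m + 1` coefficients. -/
noncomputable def coeffEquiv (R : Type) [CommRing R] (m : ℕ) : Lattice R m ≃ₗ[R] (Fin (m + 1) → R) where
  toFun p i := p.1.coeff (expo m i)
  map_add' p q := by ext; simp
  map_smul' a p := by ext; simp
  invFun f := ⟨∑ i, MvPolynomial.monomial (expo m i) (f i), Submodule.sum_mem _ fun i _ => by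
    rw [MvPolynomial.mem_homogeneousSubmodule]
    refine MvPolynomial.isHomogeneous_monomial _ ?_
    rw [Finsupp.degree_eq_sum, Fin.sum_univ_two]
    simp [expo]
    omega⟩
  left_inv p := by
    classical
    refine Subtype.ext (MvPolynomial.ext _ _ fun d => ?_)
    rw [MvPolynomial.coeff_sum]
    simp only [MvPolynomial.coeff_monomial]
    by_cases hd : d.degree = m
    · obtain ⟨i, rfl⟩ := exists_expo_eq hd
      rw [Finset.sum_eq_single i]
      · simp
      · intro j _ hj
        rw [if_neg fun h => hj (expo_injective m h)]
      · simp
    · have h0 : p.1.coeff d = 0 := by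
        by_contra h
        exact hd (by
          rw [Finsupp.degree_eq_weight_one]
          exact p.2 h)
      rw [h0]
      refine Finset.sum_eq_zero fun i _ => ?_
      split_ifs with h
      · rw [h, h0]
      · rfl
  right_inv f := by
    classical
    ext j
    simp only [MvPolynomial.coeff_sum, MvPolynomial.coeff_monomial]
    rw [Finset.sum_eq_single j]
    · simp
    · intro i _ hi
      rw [if_neg fun h => hi (expo_injective m h)]
    · simp

/-- Multiplying by a linear form. -/
theorem coeff_linear_mul_le {μ : R → ℕ} (h0 : μ 0 = 0) (hadd : ∀ x y, μ (x + y) ≤ μ x + μ y)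
    (hmul : ∀ x y, μ (x * y) ≤ μ x * μ y) (a c : R) {q : MvPolynomial (Fin 2) R} {B : ℕ}
    (hq : ∀ d, μ (q.coeff d) ≤ B) (d : Fin 2 →₀ ℕ) :
    μ (((MvPolynomial.C a * MvPolynomial.X 0 + MvPolynomial.C c * MvPolynomial.X 1) * q).coeff d)
      ≤ (μ a + μ c) * B := by
  classical
  have key : ∀ (x : R) (j : Fin 2),
      μ ((MvPolynomial.C x * (MvPolynomial.X j * q)).coeff d) ≤ μ x * B := fun x j => by
    rw [MvPolynomial.coeff_C_mul]
    refine (hmul _ _).trans (Nat.mul_le_mul le_rfl ?_)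
    rw [MvPolynomial.coeff_X_mul']
    split_ifs
    · exact hq _
    · simp [h0]
  rw [add_mul, mul_assoc, mul_assoc, MvPolynomial.coeff_add, add_mul]
  exact (hadd _ _).trans (add_le_add (key a 0) (key c 1))

theorem coeff_linear_pow_mul_le {μ : R → ℕ} (h0 : μ 0 = 0)
    (hadd : ∀ x y, μ (x + y) ≤ μ x + μ y) (hmul : ∀ x y, μ (x * y) ≤ μ x * μ y) (a c : R)
    {q : MvPolynomial (Fin 2) R} {B : ℕ} (hq : ∀ d, μ (q.coeff d) ≤ B) (i : ℕ) :
    ∀ d, μ (((MvPolynomial.C a * MvPolynomial.X 0 + MvPolynomial.C c * MvPolynomial.X 1) ^ i *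
      q).coeff d) ≤ (μ a + μ c) ^ i * B := by
  induction i with
  | zero => simpa using hq
  | succ i ih =>
    intro d
    rw [pow_succ', mul_assoc, pow_succ', mul_assoc]
    exact coeff_linear_mul_le h0 hadd hmul a c ih d

/-- The `ℤ`-basis of `Symm^m R²` built from a `ℤ`-basis of `R` and the monomials. -/
noncomputable def intBasis {κ : Type} (b : Module.Basis κ ℤ R) (m : ℕ) :
    Module.Basis (κ × Fin (m + 1)) ℤ (Lattice R m) :=
  b.smulTower (Module.Basis.ofEquivFun (coeffEquiv R m))

theorem intBasis_repr {κ : Type} (b : Module.Basis κ ℤ R) (m : ℕ) (p : Lattice R m)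
    (t : κ × Fin (m + 1)) :
    (intBasis b m).repr p t = b.repr (p.1.coeff (expo m t.2)) t.1 := by
  rw [intBasis, Module.Basis.smulTower_repr]
  rfl

theorem intBasis_apply {κ : Type} (b : Module.Basis κ ℤ R) (m : ℕ)
    (t : κ × Fin (m + 1)) :
    ((intBasis b m t : Lattice R m) : MvPolynomial (Fin 2) R) =
      MvPolynomial.monomial (expo m t.2) (b t.1) := by
  classical
  rw [intBasis, Module.Basis.smulTower_apply, Submodule.coe_smul, Module.Basis.coe_ofEquivFun]
  simp [coeffEquiv, Pi.single_apply, apply_ite, MvPolynomial.smul_monomial]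

theorem subst_monomial (γ : Matrix (Fin 2) (Fin 2) R) (m : ℕ) (i : Fin (m + 1)) (x : R) :
    subst γ (MvPolynomial.monomial (expo m i) x) =
      (MvPolynomial.C (γ 0 0) * MvPolynomial.X 0 + MvPolynomial.C (γ 1 0) * MvPolynomial.X 1)
        ^ (i : ℕ) *
      ((MvPolynomial.C (γ 0 1) * MvPolynomial.X 0 + MvPolynomial.C (γ 1 1) * MvPolynomial.X 1)
        ^ (m - i) * MvPolynomial.C x) := by
  rw [subst, MvPolynomial.aeval_monomial, expo, Finsupp.prod_add_index' (by simp)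
    (fun _ _ _ => pow_add _ _ _), Finsupp.prod_single_index (by simp),
    Finsupp.prod_single_index (by simp)]
  simp only [Fin.sum_univ_two, MvPolynomial.algebraMap_eq]
  ring

/-- The entries of the matrices of `γ` on `Symm^m R²` grow at most exponentially with `m`. -/
theorem exists_intBasis_repr_le {κ : Type} [Fintype κ] (b : Module.Basis κ ℤ R)
    (S : Set (Matrix.SpecialLinearGroup (Fin 2) R)) (hS : S.Finite) :
    ∃ C : ℕ, 1 ≤ C ∧ ∀ γ ∈ S, ∀ m s t,
      |(intBasis b m).repr (rep R m γ (intBasis b m t)) s| ≤ ((C ^ (m + 1) : ℕ) : ℤ) := by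
  obtain ⟨μ, h0, hadd, hmul, hrepr⟩ := b.exists_submultiplicative_bound
  set E : Matrix.SpecialLinearGroup (Fin 2) R → ℕ := fun γ => ∑ i, ∑ j, μ (γ i j)
  set C : ℕ := 1 + ∑ γ ∈ hS.toFinset, E γ + ∑ k, μ (b k) with hC
  refine ⟨C, by omega, fun γ hγ m s t => ?_⟩
  have hE : E γ ≤ C := by
    have := Finset.single_le_sum (f := E) (fun _ _ => Nat.zero_le _) (hS.mem_toFinset.mpr hγ)
    omega
  have hE' : E γ = μ (γ 0 0) + μ (γ 0 1) + (μ (γ 1 0) + μ (γ 1 1)) := by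
    simp [E, Fin.sum_univ_two]
  have hb : μ (b t.1) ≤ C := by
    have := Finset.single_le_sum (f := fun k => μ (b k)) (fun _ _ => Nat.zero_le _)
      (Finset.mem_univ t.1)
    omega
  rw [intBasis_repr, Int.abs_eq_natAbs]
  norm_cast
  refine (hrepr _ _).trans ?_
  change μ ((subst (γ : Matrix (Fin 2) (Fin 2) R) (intBasis b m t).1).coeff _) ≤ _
  rw [intBasis_apply, subst_monomial]
  have hC0 : ∀ d, μ ((MvPolynomial.C (b t.1) : MvPolynomial (Fin 2) R).coeff d) ≤ C := fun d => by
    classical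
    rw [MvPolynomial.coeff_C]
    split_ifs
    · exact hb
    · simp [h0]
  -- Each of the `m` linear factors, and the scalar `b t.1`, costs at most a factor `C`.
  refine (coeff_linear_pow_mul_le h0 hadd hmul _ _
    (coeff_linear_pow_mul_le h0 hadd hmul _ _ hC0 _) _ _).trans ?_
  have hi : (t.2 : ℕ) + (m - t.2) = m := by omega
  calc _ ≤ C ^ (t.2 : ℕ) * (C ^ (m - (t.2 : ℕ)) * C) :=
        Nat.mul_le_mul (Nat.pow_le_pow_left (by omega) _)
          (Nat.mul_le_mul (Nat.pow_le_pow_left (by omega) _) le_rfl)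
    _ = C ^ (m + 1) := by rw [← mul_assoc, ← pow_add, hi, pow_succ]

end SymPow

/-! ### The torsion bound for a finitely presented group -/

/-- In the basis `b` the entries of the matrix of `ρ γ` have absolute value at most `B`. -/
def Representation.EntriesBounded {G M ι : Type} [Group G] [AddCommGroup M] [m : Module ℤ M]
    (ρ : Representation ℤ G M) (b : Module.Basis ι ℤ M) (γ : G) (B : ℤ) : Prop :=
  ∀ i j, |b.repr (ρ γ (b j)) i| ≤ B

/-- The entries of `ρ ⊕ ρ*` are entries of `ρ γ` and of `ρ γ⁻¹`. -/
theorem Representation.EntriesBounded.prod_dual {G M ι : Type} [Group G] [AddCommGroup M]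
    [Module ℤ M] {ρ : Representation ℤ G M} [Finite ι] [DecidableEq ι] {b : Module.Basis ι ℤ M}
    {γ : G} {B : ℤ} (h : ρ.EntriesBounded b γ B) (h' : ρ.EntriesBounded b γ⁻¹ B) :
    Representation.EntriesBounded (M := M × Module.Dual ℤ M) (m := Prod.instModule)
      (ρ.prod ρ.dual) (b.prod b.dualBasis) γ B := by
  have hB : ∀ i : ι, 0 ≤ B := fun i => (abs_nonneg _).trans (h i i)
  rintro (i | i) (j | j)
  · simpa using h i j
  · simpa using hB i
  · simpa using hB i
  · simp only [Module.Basis.prod_apply, Sum.elim_inr, Function.comp_apply, LinearMap.inr_apply,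
      Representation.prod_apply_apply, map_zero, Module.Basis.prod_repr_inr,
      Module.Basis.dualBasis_repr, Representation.dual_apply, Module.Basis.coe_dualBasis]
    exact h' j i

/-- With `N = K * (m + 1)`, the crude bounds `N! ≤ N ^ N` and `log N ≤ N` already give a quadratic
estimate, since the second factor contributes `N * (m + 1) * log (C + 2)`. -/
theorem log_factorial_mul_pow_le (K C m : ℕ) (hC : 1 ≤ C) (hm : 1 ≤ m) {x : ℕ}
    (hx : x ≤ (K * (m + 1)).factorial * (C ^ (m + 1) + 2) ^ (K * (m + 1))) :
    Real.log x ≤ (4 * K * (K + Real.log (C + 2))) * (m : ℝ) ^ 2 := by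
  rcases Nat.eq_zero_or_pos x with rfl | hx0
  · have : 0 ≤ Real.log ((C : ℝ) + 2) := Real.log_nonneg (by linarith [C.cast_nonneg (α := ℝ)])
    simp only [Nat.cast_zero, Real.log_zero]
    positivity
  set N := K * (m + 1) with hN
  have h1 : C ^ (m + 1) + 2 ≤ (C + 2) ^ (m + 1) := by
    have h := pow_add_pow_le (Nat.zero_le C) (Nat.zero_le 2) (Nat.succ_ne_zero m)
    rw [Nat.succ_eq_add_one] at h
    have h' : 2 ≤ 2 ^ (m + 1) := Nat.le_self_pow (by omega) 2
    omega
  have h2 : x ≤ N ^ N * ((C + 2) ^ (m + 1)) ^ N :=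
    hx.trans (Nat.mul_le_mul (Nat.factorial_le_pow N) (Nat.pow_le_pow_left h1 N))
  have h3 : Real.log x ≤ Real.log ((N : ℝ) ^ N * (((C : ℝ) + 2) ^ (m + 1)) ^ N) :=
    Real.log_le_log (by exact_mod_cast hx0) (by exact_mod_cast h2)
  have hlogC : 0 ≤ Real.log ((C : ℝ) + 2) := Real.log_nonneg (by linarith [C.cast_nonneg (α := ℝ)])
  have hNN : (N : ℝ) ^ N ≠ 0 := by
    rcases Nat.eq_zero_or_pos N with h | h
    · simp [h]
    · positivity
  rw [Real.log_mul hNN (by positivity), Real.log_pow, Real.log_pow, Real.log_pow] at h3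
  have h4 : Real.log N ≤ N := Real.log_le_self (Nat.cast_nonneg N)
  have hNe : (N : ℝ) = K * (m + 1) := by simp [hN]
  have hm' : (1 : ℝ) ≤ m := by exact_mod_cast hm
  have h5 : ((m : ℝ) + 1) ^ 2 ≤ 4 * (m : ℝ) ^ 2 := by nlinarith
  calc Real.log x ≤ N * N + N * ((m + 1) * Real.log (C + 2)) := by
        refine h3.trans (add_le_add (mul_le_mul_of_nonneg_left h4 (Nat.cast_nonneg N)) ?_)
        push_cast
        exact le_rfl
    _ = K * (K + Real.log (C + 2)) * ((m : ℝ) + 1) ^ 2 := by rw [hNe]; ring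
    _ ≤ K * (K + Real.log (C + 2)) * (4 * (m : ℝ) ^ 2) :=
        mul_le_mul_of_nonneg_left h5 (by positivity)
    _ = _ := by ring

/-- The torsion bound for a finitely presented group of matrices over a ring that is finite free
over `ℤ`. -/
theorem exists_log_card_torsion_H2_le {R : Type} [CommRing R] [Module.Free ℤ R] [Module.Finite ℤ R]
    (Γ : Subgroup (Matrix.SpecialLinearGroup (Fin 2) R)) (P : TriangularPresentation Γ) :
    ∃ c : ℝ, ∀ m : ℕ, 1 ≤ m → ∀ A : Rep ℤ Γ,
      A = Rep.of (((SymPow.rep R m).prod (SymPow.rep R m).dual).comp Γ.subtype) →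
      Finite (AddCommGroup.torsion (groupCohomology A 2)) ∧
      Real.log (Nat.card (AddCommGroup.torsion (groupCohomology A 2))) ≤ c * (m : ℝ) ^ 2 := by
  classical
  have : Fintype P.S := P.finite.fintype
  let b := Module.Free.chooseBasis ℤ R
  let κ := Module.Free.ChooseBasisIndex ℤ R
  -- Inverses are included because the contragredient action of `γ` has the entries of `γ⁻¹`.
  obtain ⟨C, hC1, hC⟩ := SymPow.exists_intBasis_repr_le b
    ((Γ.subtype '' P.S) ∪ (Γ.subtype '' P.S)⁻¹) ((P.finite.image _).union (P.finite.image _).inv)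
  set K : ℕ := Fintype.card P.S * (2 * Fintype.card κ) with hK
  refine ⟨4 * K * (K + Real.log (C + 2)), fun m hm A hA => ?_⟩
  subst hA
  have hcard : Fintype.card P.S * Fintype.card ((κ × Fin (m + 1)) ⊕ (κ × Fin (m + 1))) =
      K * (m + 1) := by
    rw [Fintype.card_sum, Fintype.card_prod, Fintype.card_fin, hK]
    ring
  have h := P.card_torsion_H2_le (M := SymPow.Lattice R m × Module.Dual ℤ (SymPow.Lattice R m))
    (mod := Prod.instModule)
    (((SymPow.rep R m).prod (SymPow.rep R m).dual).comp Γ.subtype)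
    ((SymPow.intBasis b m).prod (SymPow.intBasis b m).dualBasis) (C ^ (m + 1)) fun a ha =>
      Representation.EntriesBounded.prod_dual (ρ := SymPow.rep R m) (γ := (a : _))
        (fun i j => hC _ (.inl ⟨a, ha, rfl⟩) m i j)
        (fun i j => hC _ (.inr (Set.inv_mem_inv.mpr ⟨a, ha, rfl⟩)) m i j)
  rw [hcard] at h
  exact ⟨h.1, log_factorial_mul_pow_le K C m hC1 hm h.2⟩

/-! ### Discreteness of the ring of integers in the complex plane -/

namespace ImagQuad

variable (D : ℕ)

theorem sq_gen : (((Real.sqrt (D : ℝ) : ℝ) : ℂ) * Complex.I) ^ 2 = -(D : ℂ) := by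
  rw [mul_pow, Complex.I_sq, ← Complex.ofReal_pow, Real.sq_sqrt (Nat.cast_nonneg D)]
  simp

theorem isIntegral_gen {R : Type} [CommRing R] [Algebra R ℂ] :
    IsIntegral R (((Real.sqrt (D : ℝ) : ℝ) : ℂ) * Complex.I) := by
  refine IsIntegral.of_pow (n := 2) (by norm_num) ?_
  rw [sq_gen]
  have := isIntegral_algebraMap (R := R) (A := ℂ) (x := -(D : R))
  simpa using this

instance numberField : NumberField (ImagQuadField D) where
  to_charZero := inferInstance
  to_finiteDimensional := IntermediateField.adjoin.finiteDimensional (isIntegral_gen D)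

/-- All complex absolute values of `ℚ(√-D)` agree. -/
theorem norm_embedding (φ : ImagQuadField D →+* ℂ) (x : ImagQuadField D) :
    ‖φ x‖ = ‖(x : ℂ)‖ := by
  set θ : ℂ := ((Real.sqrt (D : ℝ) : ℝ) : ℂ) * Complex.I with hθ
  have hmem : θ ∈ ImagQuadField D := IntermediateField.mem_adjoin_simple_self ℚ θ
  have hsq : φ ⟨θ, hmem⟩ ^ 2 = θ ^ 2 := by
    have h1 : (⟨θ, hmem⟩ : ImagQuadField D) ^ 2 = -(D : ImagQuadField D) := by
      apply Subtype.ext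
      push_cast
      exact sq_gen D
    rw [← map_pow, h1, sq_gen]
    simp
  have key : ∀ ψ : ImagQuadField D →+* ℂ, φ ⟨θ, hmem⟩ = ψ ⟨θ, hmem⟩ → φ x = ψ x := fun ψ h => by
    have : φ.toRatAlgHom = ψ.toRatAlgHom := by
      refine IntermediateField.algHom_ext_of_eq_adjoin ℚ (s := ({θ} : Set ℂ)) rfl fun y hy => ?_
      obtain rfl : y = θ := hy
      exact h
    exact DFunLike.congr_fun this x
  -- An embedding sends `√-D` to plus or minus itself, so it is the inclusion or its complex
  -- conjugate.
  rcases sq_eq_sq_iff_eq_or_eq_neg.mp hsq with h | h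
  · rw [key (ImagQuadField D).val.toRingHom h]
    rfl
  · rw [key ((starRingEnd ℂ).comp (ImagQuadField D).val.toRingHom) (by
      rw [h]
      simp [hθ])]
    simp

/-- The inclusion of `𝒪_D` into `ℂ`. -/
noncomputable def toComplex : ImagQuadIntegers D →+* ℂ :=
  (ImagQuadField D).val.toRingHom.comp (algebraMap _ (ImagQuadField D))

theorem toComplex_injective : Function.Injective (toComplex D) := fun _ _ h =>
  NumberField.RingOfIntegers.ext (Subtype.ext h)

/-- A bound on one absolute value bounds all conjugates, and only finitely many algebraic integers
of a number field have bounded conjugates. -/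
theorem finite_norm_le (B : ℝ) : {x : ImagQuadIntegers D | ‖toComplex D x‖ ≤ B}.Finite := by
  refine Set.Finite.of_finite_image (f := algebraMap _ (ImagQuadField D)) ?_
    (NumberField.RingOfIntegers.coe_injective.injOn)
  refine (NumberField.Embeddings.finite_of_norm_le (ImagQuadField D) ℂ B).subset ?_
  rintro _ ⟨x, hx, rfl⟩
  refine ⟨NumberField.RingOfIntegers.isIntegral_coe x, fun φ => ?_⟩
  rw [norm_embedding]
  exact hx

theorem exists_toComplex_eq :
    ∃ s, toComplex D s = ((Real.sqrt (D : ℝ) : ℝ) : ℂ) * Complex.I := by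
  have hmem := IntermediateField.mem_adjoin_simple_self ℚ
    (((Real.sqrt (D : ℝ) : ℝ) : ℂ) * Complex.I)
  have hint : IsIntegral ℤ (⟨_, hmem⟩ : ImagQuadField D) :=
    (isIntegral_algHom_iff ((ImagQuadField D).val.restrictScalars ℤ)
      Subtype.val_injective).mp (isIntegral_gen D)
  exact ⟨⟨⟨_, hmem⟩, hint⟩, rfl⟩

end ImagQuad

/-! ### Positive Hermitian forms and Siegel sets -/

namespace HermitianForm

open Matrix

/-- The value `p|x|² + 2 Re(x̄ z y) + q|y|²` of a binary Hermitian form. -/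
noncomputable def val (H : Matrix (Fin 2) (Fin 2) ℂ) (x y : ℂ) : ℝ :=
  (H 0 0).re * ‖x‖ ^ 2 + (H 1 1).re * ‖y‖ ^ 2 + 2 * (star x * H 0 1 * y).re

/-- The convex cone of Hermitian forms with `|z|² < κ p q`. -/
def cone (κ : ℝ) : Set (Matrix (Fin 2) (Fin 2) ℂ) :=
  {H | H.IsHermitian ∧ 0 < (H 0 0).re ∧ 0 < (H 1 1).re ∧
    ‖H 0 1‖ ^ 2 < κ * ((H 0 0).re * (H 1 1).re)}

/-- The Siegel set of forms that are almost reduced. -/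
def siegel (κ C : ℝ) : Set (Matrix (Fin 2) (Fin 2) ℂ) :=
  {H | H ∈ cone κ ∧ (H 0 0).re < C * (H 1 1).re ∧ ‖H 0 1‖ < C * (H 0 0).re}

variable {H : Matrix (Fin 2) (Fin 2) ℂ}

theorem diag_eq (hH : H.IsHermitian) (i : Fin 2) : H i i = ((H i i).re : ℂ) :=
  (Complex.conj_eq_iff_re.mp (hH.apply i i)).symm

theorem re_conj_apply_self (hH : H.IsHermitian) (g : Matrix (Fin 2) (Fin 2) ℂ) (j : Fin 2) :
    ((gᴴ * H * g) j j).re = val H (g 0 j) (g 1 j) := by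
  have h0 : (H 0 0).im = 0 := by rw [diag_eq hH 0]; simp
  have h1 : (H 1 1).im = 0 := by rw [diag_eq hH 1]; simp
  have h2 : H 1 0 = star (H 0 1) := (hH.apply 1 0).symm
  simp only [Matrix.mul_apply, Fin.sum_univ_two, conjTranspose_apply, val, h2,
    ← Complex.normSq_eq_norm_sq, Complex.normSq_apply, Complex.star_def, Complex.add_re,
    Complex.mul_re, Complex.mul_im, Complex.add_im, Complex.conj_re, Complex.conj_im, h0, h1]
  ring

theorem det_eq (hH : H.IsHermitian) :
    H.det = (((H 0 0).re * (H 1 1).re - ‖H 0 1‖ ^ 2 : ℝ) : ℂ) := by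
  rw [det_fin_two, ← hH.apply 1 0, diag_eq hH 0, diag_eq hH 1, Complex.star_def,
    Complex.mul_conj, Complex.normSq_eq_norm_sq]
  push_cast
  simp

theorem conj_det (hH : H.IsHermitian) (g : Matrix (Fin 2) (Fin 2) ℂ) :
    ((gᴴ * H * g) 0 0).re * ((gᴴ * H * g) 1 1).re - ‖(gᴴ * H * g) 0 1‖ ^ 2 =
      ‖g.det‖ ^ 2 * ((H 0 0).re * (H 1 1).re - ‖H 0 1‖ ^ 2) := by
  have h := det_eq (isHermitian_conjTranspose_mul_mul g hH)
  rw [det_mul, det_mul, det_conjTranspose, det_eq hH, mul_right_comm, Complex.star_def,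
    ← Complex.normSq_eq_conj_mul_self, Complex.normSq_eq_norm_sq, ← Complex.ofReal_mul] at h
  exact (Complex.ofReal_injective h).symm

theorem mul_val (H : Matrix (Fin 2) (Fin 2) ℂ) (x y : ℂ) :
    (H 0 0).re * val H x y = ‖(H 0 0).re * x + H 0 1 * y‖ ^ 2 +
      ((H 0 0).re * (H 1 1).re - ‖H 0 1‖ ^ 2) * ‖y‖ ^ 2 := by
  simp only [val, ← Complex.normSq_eq_norm_sq, Complex.normSq_apply, Complex.star_def,
    Complex.add_re, Complex.mul_re, Complex.mul_im, Complex.add_im, Complex.conj_re,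
    Complex.conj_im, Complex.ofReal_re, Complex.ofReal_im]
  ring

/-- Two applications of the arithmetic-geometric mean inequality, the second being `√κ ≤ (1 + κ) /
2`. For `κ < 1` it makes a form in `cone κ` comparable to its diagonal part. -/
theorem abs_cross_le {κ : ℝ} (hκ : 0 ≤ κ) {p q : ℝ} (hp : 0 ≤ p) (hq : 0 ≤ q) {z : ℂ}
    (hz : ‖z‖ ^ 2 ≤ κ * (p * q)) (x y : ℂ) :
    |2 * (star x * z * y).re| ≤ (1 + κ) / 2 * (p * ‖x‖ ^ 2 + q * ‖y‖ ^ 2) := by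
  have h1 : |2 * (star x * z * y).re| ≤ 2 * (‖x‖ * ‖z‖ * ‖y‖) := by
    rw [abs_mul, abs_two]
    have := Complex.abs_re_le_norm (star x * z * y)
    rw [norm_mul, norm_mul, norm_star] at this
    linarith
  refine h1.trans (abs_le_of_sq_le_sq' ?_ (by positivity)).2
  have hx := sq_nonneg ‖x‖
  have hy := sq_nonneg ‖y‖
  have h2 : (2 * (‖x‖ * ‖z‖ * ‖y‖)) ^ 2 ≤ 4 * κ * ((p * ‖x‖ ^ 2) * (q * ‖y‖ ^ 2)) := by
    have := mul_le_mul_of_nonneg_right hz (mul_nonneg hx hy)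
    nlinarith
  have h3 : 4 * ((p * ‖x‖ ^ 2) * (q * ‖y‖ ^ 2)) ≤ (p * ‖x‖ ^ 2 + q * ‖y‖ ^ 2) ^ 2 := by
    nlinarith [sq_nonneg (p * ‖x‖ ^ 2 - q * ‖y‖ ^ 2)]
  have h4 : κ ≤ ((1 + κ) / 2) ^ 2 := by nlinarith [sq_nonneg (1 - κ)]
  calc _ ≤ κ * (4 * ((p * ‖x‖ ^ 2) * (q * ‖y‖ ^ 2))) := by linarith
    _ ≤ ((1 + κ) / 2) ^ 2 * (p * ‖x‖ ^ 2 + q * ‖y‖ ^ 2) ^ 2 :=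
      mul_le_mul h4 h3 (by positivity) (by positivity)
    _ = _ := by ring

theorem le_val {κ : ℝ} (hκ : 0 ≤ κ) (h : H ∈ cone κ) (x y : ℂ) :
    (1 - κ) / 2 * ((H 0 0).re * ‖x‖ ^ 2 + (H 1 1).re * ‖y‖ ^ 2) ≤ val H x y := by
  have := (abs_le.mp (abs_cross_le hκ h.2.1.le h.2.2.1.le h.2.2.2.le x y)).1
  rw [val]
  linarith

theorem val_le (h : H ∈ cone 1) (x y : ℂ) :
    val H x y ≤ 2 * ((H 0 0).re * ‖x‖ ^ 2 + (H 1 1).re * ‖y‖ ^ 2) := by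
  have := (abs_le.mp (abs_cross_le zero_le_one h.2.1.le h.2.2.1.le h.2.2.2.le x y)).2
  rw [val]
  linarith

theorem exists_mem_cone (h : H ∈ cone 1) : ∃ κ, 0 ≤ κ ∧ κ < 1 ∧ H ∈ cone κ := by
  obtain ⟨h1, h2, h3, h4⟩ := h
  have hpq := mul_pos h2 h3
  obtain ⟨κ, hκ, hκ1⟩ := exists_between ((div_lt_one hpq).mpr (by linarith : ‖H 0 1‖ ^ 2 < _))
  exact ⟨κ, (by positivity : 0 ≤ ‖H 0 1‖ ^ 2 / _).trans hκ.le, hκ1, h1, h2, h3,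
    (div_lt_iff₀ hpq).mp hκ⟩

theorem val_pos (h : H ∈ cone 1) {x y : ℂ} (hxy : x ≠ 0 ∨ y ≠ 0) : 0 < val H x y := by
  obtain ⟨κ, hκ, hκ1, h'⟩ := exists_mem_cone h
  refine lt_of_lt_of_le (mul_pos (by linarith) ?_) (le_val hκ h' x y)
  have hp := h.2.1
  have hq := h.2.2.1
  rcases hxy with hx | hx <;> positivity

/-- Invertible matrices preserve positive definiteness. -/
theorem conj_mem_cone (h : H ∈ cone 1) {g : Matrix (Fin 2) (Fin 2) ℂ} (hg : g.det ≠ 0) :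
    gᴴ * H * g ∈ cone 1 := by
  refine ⟨isHermitian_conjTranspose_mul_mul g h.1, ?_, ?_, ?_⟩
  · rw [re_conj_apply_self h.1]
    refine val_pos h ?_
    by_contra! hc
    exact hg (by rw [det_fin_two, hc.1, hc.2]; ring)
  · rw [re_conj_apply_self h.1]
    refine val_pos h ?_
    by_contra! hc
    exact hg (by rw [det_fin_two, hc.1, hc.2]; ring)
  · have h1 := conj_det h.1 g
    have h2 := h.2.2.2
    have h3 : 0 < ‖g.det‖ ^ 2 * ((H 0 0).re * (H 1 1).re - ‖H 0 1‖ ^ 2) :=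
      mul_pos (by positivity) (by linarith)
    linarith

theorem smul_mem_cone {κ t : ℝ} (ht : 0 < t) (h : H ∈ cone κ) : t • H ∈ cone κ := by
  obtain ⟨h1, h2, h3, h4⟩ := h
  refine ⟨?_, ?_, ?_, ?_⟩
  · rw [IsHermitian, conjTranspose_smul, h1.eq, star_trivial]
  · simpa using mul_pos ht h2
  · simpa using mul_pos ht h3
  · simp only [Matrix.smul_apply, Complex.real_smul, Complex.re_ofReal_mul, norm_mul, Complex.norm_real,
      Real.norm_eq_abs, mul_pow, sq_abs]
    nlinarith [mul_lt_mul_of_pos_left h4 (pow_pos ht 2)]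

theorem add_mem_cone {κ : ℝ} (hκ : 0 < κ) {H' : Matrix (Fin 2) (Fin 2) ℂ} (h : H ∈ cone κ)
    (h' : H' ∈ cone κ) : H + H' ∈ cone κ := by
  obtain ⟨h1, h2, h3, h4⟩ := h
  obtain ⟨h1', h2', h3', h4'⟩ := h'
  refine ⟨h1.add h1', by simpa using add_pos h2 h2', by simpa using add_pos h3 h3', ?_⟩
  simp only [Matrix.add_apply, Complex.add_re]
  set p := (H 0 0).re
  set q := (H 1 1).re
  set p' := (H' 0 0).re
  set q' := (H' 1 1).re
  have hn := norm_add_le (H 0 1) (H' 0 1)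
  have hn' : ‖H 0 1 + H' 0 1‖ ^ 2 ≤ (‖H 0 1‖ + ‖H' 0 1‖) ^ 2 :=
    pow_le_pow_left₀ (norm_nonneg _) hn 2
  -- Multiplying the two defining inequalities and applying the arithmetic-geometric mean inequality
  -- to `p * q'` and `p' * q`.
  have hcross : 2 * (‖H 0 1‖ * ‖H' 0 1‖) ≤ κ * (p * q' + p' * q) := by
    refine (abs_le_of_sq_le_sq' ?_ (by positivity)).2
    have hm := mul_le_mul h4.le h4'.le (sq_nonneg _) (by positivity)
    have : 4 * (p * q' * (p' * q)) ≤ (p * q' + p' * q) ^ 2 := by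
      nlinarith [sq_nonneg (p * q' - p' * q)]
    nlinarith [mul_le_mul_of_nonneg_left this (sq_nonneg κ)]
  nlinarith

theorem convex_of_add_smul {S : Set (Matrix (Fin 2) (Fin 2) ℂ)}
    (hadd : ∀ A ∈ S, ∀ B ∈ S, A + B ∈ S) (hsmul : ∀ t : ℝ, 0 < t → ∀ A ∈ S, t • A ∈ S) :
    Convex ℝ S := by
  intro A hA B hB a b ha hb hab
  rcases ha.eq_or_lt with rfl | ha
  · have : b = 1 := by linarith
    simpa [this] using hB
  rcases hb.eq_or_lt with rfl | hb
  · have : a = 1 := by linarith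
    simpa [this] using hA
  exact hadd _ (hsmul a ha A hA) _ (hsmul b hb B hB)

theorem convex_cone {κ : ℝ} (hκ : 0 < κ) : Convex ℝ (cone κ) :=
  convex_of_add_smul (fun _ h _ h' => add_mem_cone hκ h h') (fun _ ht _ h => smul_mem_cone ht h)

theorem smul_mem_siegel {κ C t : ℝ} (ht : 0 < t) (h : H ∈ siegel κ C) : t • H ∈ siegel κ C := by
  refine ⟨smul_mem_cone ht h.1, ?_, ?_⟩
  · simpa [mul_left_comm] using mul_lt_mul_of_pos_left h.2.1 ht
  · simpa [abs_of_pos ht, mul_left_comm] using mul_lt_mul_of_pos_left h.2.2 ht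

theorem convex_siegel {κ C : ℝ} (hκ : 0 < κ) : Convex ℝ (siegel κ C) := by
  refine convex_of_add_smul (fun A h B h' => ⟨add_mem_cone hκ h.1 h'.1, ?_, ?_⟩)
    (fun t ht A h => smul_mem_siegel ht h)
  · have h1 := h.2.1
    have h2 := h'.2.1
    simp only [Matrix.add_apply, Complex.add_re]
    linarith
  · have h1 := h.2.2
    have h2 := h'.2.2
    have := norm_add_le (A 0 1) (B 0 1)
    simp only [Matrix.add_apply, Complex.add_re]
    linarith

theorem one_mem_siegel {κ C : ℝ} (hκ : 0 < κ) (hC : 1 < C) : 1 ∈ siegel κ C := by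
  refine ⟨⟨isHermitian_one, ?_, ?_, ?_⟩, ?_, ?_⟩ <;> simp [hκ, hC]
  linarith

end HermitianForm

/-! ### The Siegel finiteness property -/

namespace HermitianForm

open Matrix

variable {H : Matrix (Fin 2) (Fin 2) ℂ}

/-- If two almost reduced forms are related by `g`, the products of opposite entries of `g` are
bounded in terms of `det g`. -/
theorem mul_le_mul_of_conj_mem_siegel {κ B : ℝ} (hκ1 : κ < 1)
    {g : Matrix (Fin 2) (Fin 2) ℂ} (hB : ‖g.det‖ ≤ B) (hH : H ∈ cone κ)
    (hH' : gᴴ * H * g ∈ cone κ) :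
    ((gᴴ * H * g) 0 0).re * ((gᴴ * H * g) 1 1).re ≤
      B ^ 2 / (1 - κ) * ((H 0 0).re * (H 1 1).re) := by
  -- Since `κ < 1`, the product of the diagonal entries is comparable to the determinant, which `g`
  -- scales by `‖g.det‖ ^ 2`.
  have h1 := conj_det hH.1 g
  have h2 := hH'.2.2.2
  have hpq := mul_pos hH.2.1 hH.2.2.1
  have h3 : ‖g.det‖ ^ 2 * ((H 0 0).re * (H 1 1).re - ‖H 0 1‖ ^ 2) ≤
      B ^ 2 * ((H 0 0).re * (H 1 1).re) :=
    mul_le_mul (pow_le_pow_left₀ (norm_nonneg _) hB 2) (by nlinarith [sq_nonneg ‖H 0 1‖])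
      (by nlinarith [hH.2.2.2]) (by positivity)
  rw [div_mul_eq_mul_div, le_div_iff₀ (by linarith)]
  nlinarith

/-- Bounds for the entries of a matrix with `c ≠ 0` relating almost reduced forms; here `a, b, c, d`
are the squared absolute values of the entries. -/
theorem sq_entries_le {C l K p q p' q' a b c d : ℝ} (hC : 1 < C) (hl0 : 0 < l) (hK0 : 0 ≤ K)
    (hp : 0 < p) (hq : 0 < q) (hp0' : 0 < p') (hq0' : 0 < q') (hpCq : p < C * q)
    (hpCq' : p' < C * q') (hprod : p' * q' ≤ K * (p * q)) (ha : 0 ≤ a) (hc : 1 ≤ c) (hb : 0 ≤ b)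
    (hd : 0 ≤ d) (hbd : 1 ≤ b ∨ 1 ≤ d) (hp' : l * (p * a + q * c) ≤ p')
    (hq' : l * (p * b + q * d) ≤ q') :
    (a ≤ K * C ^ 2 * (1 + C * K / l ^ 2) ^ 2 / l ^ 2 ∧
      c ≤ K * C ^ 2 * (1 + C * K / l ^ 2) ^ 2 / l ^ 2) ∧
    b ≤ K * C ^ 2 * (1 + C * K / l ^ 2) ^ 2 / l ^ 2 ∧
      d ≤ K * C ^ 2 * (1 + C * K / l ^ 2) ^ 2 / l ^ 2 := by
  set L : ℝ := C * K / l ^ 2 with hL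
  have hL0 : 0 ≤ L := by positivity
  have hC0 : 0 < C := by linarith
  have hp1 : l * q ≤ p' := by
    refine (mul_le_mul_of_nonneg_left ?_ hl0.le).trans hp'
    have h1 := le_mul_of_one_le_right hq.le hc
    have h2 := mul_nonneg hp.le ha
    linarith
  -- Here `c ≥ 1` enters: `(l q)² ≤ p'² ≤ C p' q' ≤ C K p q`. Together with `p < C q` this makes `p`
  -- and `q` comparable.
  have hqL : q ≤ L * p := by
    have h1 : (l * q) * (l * q) ≤ C * (K * (p * q)) :=
      calc (l * q) * (l * q) ≤ p' * p' := mul_le_mul hp1 hp1 (by positivity) hp0'.le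
        _ ≤ p' * (C * q') := mul_le_mul_of_nonneg_left hpCq'.le hp0'.le
        _ = C * (p' * q') := by ring
        _ ≤ _ := mul_le_mul_of_nonneg_left hprod hC0.le
    have h2 : l ^ 2 * q ≤ C * K * p := by
      refine le_of_mul_le_mul_right ?_ hq
      calc _ = (l * q) * (l * q) := by ring
        _ ≤ _ := h1
        _ = _ := by ring
    rw [hL, div_mul_eq_mul_div, le_div_iff₀ (by positivity)]
    linarith
  -- whichever of `l * p`, `l * q` is below `v`, both are below a multiple of `v`
  have both : ∀ v, 0 < v → (l * p ≤ v ∨ l * q ≤ v) →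
      l * p ≤ C * (1 + L) * v ∧ l * q ≤ C * (1 + L) * v := by
    intro v hv h
    have e1 : l * p ≤ C * (l * q) := by
      have := mul_le_mul_of_nonneg_left hpCq.le hl0.le
      linarith
    have e2 : l * q ≤ L * (l * p) := by
      have := mul_le_mul_of_nonneg_left hqL hl0.le
      linarith
    have e3 : v ≤ C * v := le_mul_of_one_le_left hv.le hC.le
    have e4 : 0 ≤ C * (L * v) := by positivity
    have e5 : L * v ≤ C * (L * v) := le_mul_of_one_le_left (by positivity) hC.le
    rcases h with h | h
    · have := mul_le_mul_of_nonneg_left h hL0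
      constructor <;> linarith
    · have := mul_le_mul_of_nonneg_left h hC0.le
      constructor <;> linarith
  -- Because `u * v` is bounded above, a lower bound for one new diagonal entry `v` is an upper
  -- bound for the other, `u`.
  have bound : ∀ u v : ℝ, 0 < u → 0 < v → u * v ≤ K * (p * q) → (l * p ≤ v ∨ l * q ≤ v) →
      u * l ≤ K * C * (1 + L) * q ∧ u * l ≤ K * C * (1 + L) * p := by
    intro u v hu hv huv h
    obtain ⟨h1, h2⟩ := both v hv h
    constructor
    · refine le_of_mul_le_mul_right ?_ hp
      calc u * l * p = u * (l * p) := by ring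
        _ ≤ u * (C * (1 + L) * v) := mul_le_mul_of_nonneg_left h1 hu.le
        _ = C * (1 + L) * (u * v) := by ring
        _ ≤ C * (1 + L) * (K * (p * q)) := mul_le_mul_of_nonneg_left huv (by positivity)
        _ = _ := by ring
    · refine le_of_mul_le_mul_right ?_ hq
      calc u * l * q = u * (l * q) := by ring
        _ ≤ u * (C * (1 + L) * v) := mul_le_mul_of_nonneg_left h2 hu.le
        _ = C * (1 + L) * (u * v) := by ring
        _ ≤ C * (1 + L) * (K * (p * q)) := mul_le_mul_of_nonneg_left huv (by positivity)
        _ = _ := by ring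
  have hKC : K * C * (1 + L) ≤ K * C ^ 2 * (1 + L) ^ 2 := by
    have h1 : 1 ≤ C * (1 + L) := by
      have := mul_nonneg hC0.le hL0
      linarith
    calc K * C * (1 + L) ≤ K * C * (1 + L) * (C * (1 + L)) :=
          le_mul_of_one_le_right (by positivity) h1
      _ = _ := by ring
  have entries : ∀ u x y : ℝ, 0 ≤ x → 0 ≤ y → l * (p * x + q * y) ≤ u →
      (u * l ≤ K * C * (1 + L) * q ∧ u * l ≤ K * C * (1 + L) * p) →
      x ≤ K * C ^ 2 * (1 + L) ^ 2 / l ^ 2 ∧ y ≤ K * C ^ 2 * (1 + L) ^ 2 / l ^ 2 := by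
    intro u x y hx hy hu huu
    have hul := mul_le_mul_of_nonneg_right hu hl0.le
    constructor
    · rw [le_div_iff₀ (by positivity)]
      refine (le_of_mul_le_mul_right ?_ hp).trans hKC
      have : 0 ≤ l ^ 2 * (q * y) := by positivity
      linarith [huu.2]
    · rw [le_div_iff₀ (by positivity)]
      refine (le_of_mul_le_mul_right ?_ hq).trans hKC
      have : 0 ≤ l ^ 2 * (p * x) := by positivity
      linarith [huu.1]
  refine ⟨entries p' a c ha (by linarith) hp' (bound p' q' hp0' hq0' hprod ?_),
    entries q' b d hb hd hq' (bound q' p' hq0' hp0' (by linarith) (.inr hp1))⟩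
  rcases hbd with h | h
  · refine .inl ((mul_le_mul_of_nonneg_left ?_ hl0.le).trans hq')
    have h1 := le_mul_of_one_le_right hp.le h
    have h2 := mul_nonneg hq.le hd
    linarith
  · refine .inr ((mul_le_mul_of_nonneg_left ?_ hl0.le).trans hq')
    have h1 := le_mul_of_one_le_right hq.le h
    have h2 := mul_nonneg hp.le hb
    linarith

/-- The Siegel property: a matrix with entries in a discrete set relating two almost reduced forms
has bounded entries. -/
theorem exists_norm_le_of_conj_mem_siegel {κ C B : ℝ} (hκ : 0 < κ) (hκ1 : κ < 1) (hC : 1 < C) :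
    ∃ M : ℝ, ∀ H ∈ siegel κ C, ∀ g : Matrix (Fin 2) (Fin 2) ℂ,
      (∀ i j, g i j ≠ 0 → 1 ≤ ‖g i j‖) → g.det ≠ 0 → ‖g.det‖ ≤ B →
      gᴴ * H * g ∈ siegel κ C → ∀ i j, ‖g i j‖ ≤ M := by
  set K : ℝ := B ^ 2 / (1 - κ) with hK
  set l : ℝ := (1 - κ) / 2 with hl
  have hl0 : 0 < l := by rw [hl]; linarith
  have hK0 : 0 ≤ K := div_nonneg (sq_nonneg B) (by linarith)
  set K₂ : ℝ := K / l ^ 2 with hK₂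
  have hK₂0 : 0 ≤ K₂ := by positivity
  set T : ℝ := K * C ^ 2 * (1 + C * K / l ^ 2) ^ 2 / l ^ 2
  have hT0 : 0 ≤ T := by positivity
  have norm_le : ∀ {x : ℂ} {t : ℝ}, ‖x‖ ^ 2 ≤ t → ‖x‖ ≤ t + 1 := fun {x t} h => by
    nlinarith [sq_nonneg (‖x‖ - 1)]
  refine ⟨(K₂ + 1) + 2 * C * (K₂ + 1) + (T + 1), fun H hH g hg hdet hB hH' => ?_⟩
  have hprod := mul_le_mul_of_conj_mem_siegel hκ1 hB hH.1 hH'.1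
  have hp' := le_val hκ.le hH.1 (g 0 0) (g 1 0)
  have hq' := le_val hκ.le hH.1 (g 0 1) (g 1 1)
  rw [← re_conj_apply_self hH.1.1] at hp' hq'
  obtain ⟨⟨hherm, hp, hq, -⟩, hpCq, hz⟩ := hH
  obtain ⟨⟨-, hp0', hq0', -⟩, hpCq', hz'⟩ := hH'
  rw [← hK] at hprod
  rw [← hl] at hp' hq'
  have hz01 : g 1 0 = 0 → (gᴴ * H * g) 0 1 = star (g 0 0) * ((H 0 0).re * g 0 1 + H 0 1 * g 1 1) :=
    fun h => by
      simp only [mul_apply, Fin.sum_univ_two, conjTranspose_apply, h, star_zero, zero_mul, add_zero]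
      rw [← diag_eq hherm 0]
      ring
  have hp'' : g 1 0 = 0 → ((gᴴ * H * g) 0 0).re = (H 0 0).re * ‖g 0 0‖ ^ 2 := fun h => by
    rw [re_conj_apply_self hherm, val, h]
    simp
  set p := (H 0 0).re
  set q := (H 1 1).re
  set p' := ((gᴴ * H * g) 0 0).re
  set q' := ((gᴴ * H * g) 1 1).re
  set a := g 0 0 with ha
  set b := g 0 1 with hb
  set c := g 1 0 with hc
  set d := g 1 1 with hd
  have hpq : 0 < p * q := mul_pos hp hq
  -- In the triangular case `a` and `d` have modulus at least `1` and bounded product, and `b` is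
  -- controlled by the off-diagonal Siegel condition. Otherwise `sq_entries_le` bounds all entries.
  by_cases hc0 : c = 0
  · have hdet' : a * d ≠ 0 := by
      rw [det_fin_two, ← ha, ← hb, ← hc, ← hd, hc0, mul_zero, sub_zero] at hdet
      exact hdet
    have ha1 : 1 ≤ ‖a‖ := hg 0 0 (left_ne_zero_of_mul hdet')
    have hd1 : 1 ≤ ‖d‖ := hg 1 1 (right_ne_zero_of_mul hdet')
    have hmul : ‖a‖ ^ 2 * ‖d‖ ^ 2 ≤ K₂ := by
      have h1 : (l * (p * ‖a‖ ^ 2)) * (l * (q * ‖d‖ ^ 2)) ≤ p' * q' := by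
        refine mul_le_mul ((mul_le_mul_of_nonneg_left ?_ hl0.le).trans hp')
          ((mul_le_mul_of_nonneg_left ?_ hl0.le).trans hq') (by positivity) hp0'.le
        · nlinarith [mul_nonneg hq.le (sq_nonneg ‖c‖)]
        · nlinarith [mul_nonneg hp.le (sq_nonneg ‖b‖)]
      rw [hK₂, le_div_iff₀ (by positivity)]
      refine le_of_mul_le_mul_right ?_ hpq
      calc _ = (l * (p * ‖a‖ ^ 2)) * (l * (q * ‖d‖ ^ 2)) := by ring
        _ ≤ _ := h1.trans hprod
    have haK : ‖a‖ ^ 2 ≤ K₂ :=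
      (le_mul_of_one_le_right (sq_nonneg _) (one_le_pow₀ hd1)).trans hmul
    have hdK : ‖d‖ ^ 2 ≤ K₂ :=
      (le_mul_of_one_le_left (sq_nonneg _) (one_le_pow₀ ha1)).trans hmul
    have ha2 := norm_le haK
    have hd2 := norm_le hdK
    have hb2 : ‖b‖ ≤ 2 * C * (K₂ + 1) := by
      rw [hz01 hc0, hp'' hc0, norm_mul, norm_star] at hz'
      have h1 : p * ‖b‖ - ‖H 0 1‖ * ‖d‖ ≤ ‖(p : ℂ) * b + H 0 1 * d‖ := by
        have := norm_sub_le ((p : ℂ) * b + H 0 1 * d) (H 0 1 * d)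
        rw [add_sub_cancel_right, norm_mul, norm_mul, Complex.norm_real, Real.norm_eq_abs,
          abs_of_pos hp] at this
        linarith
      have h2 : ‖a‖ * ‖(p : ℂ) * b + H 0 1 * d‖ < ‖a‖ * (C * p * ‖a‖) := by
        calc _ < C * (p * ‖a‖ ^ 2) := hz'
          _ = _ := by ring
      have h3 := lt_of_mul_lt_mul_left h2 (norm_nonneg a)
      have h4 : ‖H 0 1‖ * ‖d‖ ≤ C * p * ‖d‖ :=
        mul_le_mul_of_nonneg_right hz.le (norm_nonneg d)
      have h5 : p * ‖b‖ ≤ p * (C * (‖a‖ + ‖d‖)) := by linarith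
      have h6 := le_of_mul_le_mul_left h5 hp
      have h7 : C * (‖a‖ + ‖d‖) ≤ C * ((K₂ + 1) + (K₂ + 1)) :=
        mul_le_mul_of_nonneg_left (by linarith) (by linarith)
      linarith
    have hnn : 0 ≤ 2 * C * (K₂ + 1) := by positivity
    intro i j
    fin_cases i <;> fin_cases j
    · change ‖a‖ ≤ _; linarith
    · change ‖b‖ ≤ _; linarith
    · change ‖c‖ ≤ _; rw [hc0, norm_zero]; linarith
    · change ‖d‖ ≤ _; linarith
  · have hbd : 1 ≤ ‖b‖ ^ 2 ∨ 1 ≤ ‖d‖ ^ 2 := by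
      by_cases hb0 : b = 0
      · refine .inr (one_le_pow₀ (hg 1 1 fun hd0 => hdet ?_))
        rw [det_fin_two, ← hb, ← hd, hb0, hd, hd0]
        ring
      · exact .inl (one_le_pow₀ (hg 0 1 hb0))
    obtain ⟨⟨hA, hC'⟩, hB', hD⟩ := sq_entries_le hC hl0 hK0 hp hq hp0' hq0' hpCq hpCq' hprod
      (sq_nonneg _) (one_le_pow₀ (hg 1 0 hc0)) (sq_nonneg _) (sq_nonneg _) hbd hp' hq'
    have hA := norm_le hA
    have hC' := norm_le hC'
    have hB' := norm_le hB'
    have hD := norm_le hD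
    have hnn : 0 ≤ 2 * C * (K₂ + 1) := by positivity
    intro i j
    fin_cases i <;> fin_cases j
    · change ‖a‖ ≤ _; linarith
    · change ‖b‖ ≤ _; linarith
    · change ‖c‖ ≤ _; linarith
    · change ‖d‖ ≤ _; linarith

end HermitianForm

/-! ### Diophantine approximation and reduction theory -/

/-- Simultaneous Dirichlet approximation. -/
theorem exists_simultaneous_approximation {ι : Type} [Fintype ι] (M : ℕ) (hM : 0 < M) :
    ∃ N : ℕ, ∀ x : ι → ℝ, ∃ n : ℕ, 1 ≤ n ∧ n ≤ N ∧ ∃ k : ι → ℤ, ∀ i, |n * x i - k i| ≤ 1 / M := by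
  classical
  refine ⟨Fintype.card (ι → Fin M), fun x => ?_⟩
  have hM' : (0 : ℝ) < M := by exact_mod_cast hM
  have hlt : ∀ y : ℝ, ⌊M * Int.fract y⌋₊ < M := fun y => by
    rw [Nat.floor_lt (by have := Int.fract_nonneg y; positivity)]
    nlinarith [Int.fract_lt_one y]
  -- Pigeonhole: one more multiple of `x` than there are boxes of side `1 / M` in the unit cube.
  obtain ⟨j₁, j₂, hne, heq⟩ := Fintype.exists_ne_map_eq_of_card_lt
    (fun (j : Fin (Fintype.card (ι → Fin M) + 1)) (i : ι) =>
      (⟨⌊M * Int.fract ((j : ℕ) * x i)⌋₊, hlt _⟩ : Fin M)) (by simp)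
  wlog hj : j₁ < j₂ generalizing j₁ j₂
  · exact this j₂ j₁ hne.symm heq.symm (lt_of_le_of_ne (not_lt.mp hj) hne.symm)
  have hj' : (j₁ : ℕ) < j₂ := hj
  refine ⟨j₂ - j₁, by omega, by omega, fun i => ⌊(j₂ : ℕ) * x i⌋ - ⌊(j₁ : ℕ) * x i⌋, fun i => ?_⟩
  have h := congrFun heq i
  rw [Fin.mk.injEq] at h
  have e1 := Int.self_sub_floor ((j₁ : ℕ) * x i)
  have e2 := Int.self_sub_floor ((j₂ : ℕ) * x i)
  set f₁ := Int.fract ((j₁ : ℕ) * x i)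
  set f₂ := Int.fract ((j₂ : ℕ) * x i)
  have hf : ∀ y : ℝ, 0 ≤ M * Int.fract y := fun y => by have := Int.fract_nonneg y; positivity
  have a1 := Nat.floor_le (hf ((j₁ : ℕ) * x i))
  have a2 := Nat.lt_floor_add_one (M * f₁)
  have a3 := Nat.floor_le (hf ((j₂ : ℕ) * x i))
  have a4 := Nat.lt_floor_add_one (M * f₂)
  rw [h] at a1 a2
  have e3 : ((j₂ - j₁ : ℕ) : ℝ) * x i - ((⌊(j₂ : ℕ) * x i⌋ - ⌊(j₁ : ℕ) * x i⌋ : ℤ) : ℝ) =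
      f₂ - f₁ := by
    rw [Nat.cast_sub hj'.le]
    push_cast
    linarith
  rw [e3, le_div_iff₀ hM', ← abs_of_pos hM', ← abs_mul, abs_le]
  constructor <;> linarith

namespace HermitianForm

open Matrix

theorem val_conj {H : Matrix (Fin 2) (Fin 2) ℂ} (hH : H.IsHermitian)
    (g : Matrix (Fin 2) (Fin 2) ℂ) (x y : ℂ) :
    val (gᴴ * H * g) x y = val H (g 0 0 * x + g 0 1 * y) (g 1 0 * x + g 1 1 * y) := by
  have h1 := re_conj_apply_self (isHermitian_conjTranspose_mul_mul g hH) !![x, 0; y, 0] 0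
  have h2 := re_conj_apply_self hH (g * !![x, 0; y, 0]) 0
  rw [conjTranspose_mul] at h2
  simp only [Matrix.mul_assoc] at h1 h2
  rw [h1] at h2
  simpa [Matrix.mul_apply, Fin.sum_univ_two, Matrix.mul_assoc] using h2

end HermitianForm

/-- A subring of `ℂ`, given by an embedding, that is discrete and contains a purely imaginary
element. -/
structure DiscreteEmbedding (O : Type) [CommRing O] where
  e : O →+* ℂ
  inj : Function.Injective e
  finite : ∀ B : ℝ, {x | ‖e x‖ ≤ B}.Finite
  s : O
  σ : ℝ
  σ_pos : 0 < σ
  e_s : e s = σ * Complex.I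

namespace DiscreteEmbedding

open Matrix HermitianForm

variable {O : Type} [CommRing O] (E : DiscreteEmbedding O)

/-- A nonzero element of modulus below `1` would have infinitely many distinct powers in the unit
disc, contradicting discreteness. -/
theorem one_le_norm {x : O} (hx : x ≠ 0) : 1 ≤ ‖E.e x‖ := by
  by_contra! h
  have h0 : 0 < ‖E.e x‖ := norm_pos_iff.mpr ((map_ne_zero_iff _ E.inj).mpr hx)
  refine Set.infinite_range_of_injective (f := fun n : ℕ => x ^ n) (fun m n hmn => ?_)
    ((E.finite 1).subset ?_)
  · have : ‖E.e x‖ ^ m = ‖E.e x‖ ^ n := by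
      rw [← norm_pow, ← norm_pow, ← map_pow, ← map_pow]
      exact congrArg (fun y => ‖E.e y‖) hmn
    exact (pow_right_strictAnti₀ h0 h).injective this
  · rintro _ ⟨n, rfl⟩
    simpa using pow_le_one₀ (norm_nonneg _) h.le

theorem norm_sub_le (α : ℂ) (k l : ℤ) :
    ‖α - E.e (k + l * E.s)‖ ≤ |α.re - k| + E.σ * |α.im / E.σ - l| := by
  refine (Complex.norm_le_abs_re_add_abs_im _).trans_eq ?_
  have h : E.e (k + l * E.s) = (k : ℂ) + l * (E.σ * Complex.I) := by
    simp [E.e_s]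
  have h2 : E.σ * |α.im / E.σ - l| = |α.im - l * E.σ| := by
    conv_lhs => rw [← abs_of_pos E.σ_pos, ← abs_mul, abs_of_pos E.σ_pos]
    congr 1
    have := E.σ_pos.ne'
    field_simp
  rw [h, h2]
  simp

theorem exists_norm_sub_le (α : ℂ) : ∃ a, ‖α - E.e a‖ ≤ 1 + E.σ := by
  refine ⟨_, (E.norm_sub_le α (round α.re) (round (α.im / E.σ))).trans ?_⟩
  have h1 := abs_sub_round α.re
  have h2 := abs_sub_round (α.im / E.σ)
  have := mul_le_mul_of_nonneg_left h2 E.σ_pos.le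
  linarith [E.σ_pos]

/-- Dirichlet approximation of the coordinates with respect to `1` and `E.s`. The tolerance `1 / 3`
serves the reduction: it makes `2 * (1/9 + 1/9) < 1`. -/
theorem exists_approximation :
    ∃ N : ℕ, ∀ α : Fin 2 → ℂ, ∃ n : ℕ, 1 ≤ n ∧ n ≤ N ∧
      ∃ a : Fin 2 → O, ∀ i, ‖n * α i - E.e (a i)‖ ≤ 1 / 3 := by
  obtain ⟨M, hM⟩ := exists_nat_gt (3 * (1 + E.σ))
  have hM0 : (0 : ℝ) < M := by linarith [E.σ_pos]
  obtain ⟨N, hN⟩ := exists_simultaneous_approximation (ι := Fin 2 × Fin 2) M (by exact_mod_cast hM0)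
  refine ⟨N, fun α => ?_⟩
  obtain ⟨n, hn1, hnN, k, hk⟩ := hN fun t => ![(α t.1).re, (α t.1).im / E.σ] t.2
  refine ⟨n, hn1, hnN, fun i => k (i, 0) + k (i, 1) * E.s, fun i => ?_⟩
  refine (E.norm_sub_le _ _ _).trans ?_
  have h0 := hk (i, 0)
  have h1 := hk (i, 1)
  simp only [cons_val_zero, cons_val_one] at h0 h1
  have e0 : ((n : ℂ) * α i).re = n * (α i).re := by simp
  have e1 : ((n : ℂ) * α i).im / E.σ = n * ((α i).im / E.σ) := by simp [mul_div_assoc]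
  rw [e0, e1]
  have h2 := mul_le_mul_of_nonneg_left h1 E.σ_pos.le
  have h3 : (1 + E.σ) * (1 / M) ≤ 1 / 3 := by
    rw [mul_one_div, div_le_div_iff₀ hM0 (by norm_num)]
    linarith
  linarith

/-- A positive form attains its minimum on any nonempty set of vectors of `O²`. -/
theorem exists_min {H : Matrix (Fin 2) (Fin 2) ℂ} (hH : H ∈ cone 1) (Q : O × O → Prop)
    (hQ : ∃ v, Q v) :
    ∃ v, Q v ∧ ∀ u, Q u → val H (E.e v.1) (E.e v.2) ≤ val H (E.e u.1) (E.e u.2) := by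
  obtain ⟨v₀, hv₀⟩ := hQ
  obtain ⟨κ, hκ, hκ1, hH'⟩ := exists_mem_cone hH
  set f : O × O → ℝ := fun v => val H (E.e v.1) (E.e v.2)
  have hp := hH.2.1
  have hq := hH.2.2.1
  set l := (1 - κ) / 2 with hl
  have hl0 : 0 < l := by rw [hl]; linarith
  have hfin : {v | f v ≤ f v₀}.Finite := by
    have hsq : ∀ {x : ℂ} {t : ℝ}, ‖x‖ ^ 2 ≤ t → ‖x‖ ≤ t + 1 := fun {x t} h => by
      nlinarith [sq_nonneg (‖x‖ - 1)]
    refine ((E.finite (f v₀ / (l * (H 0 0).re) + 1)).prod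
      (E.finite (f v₀ / (l * (H 1 1).re) + 1))).subset fun v hv => ?_
    have h := (le_val hκ hH' (E.e v.1) (E.e v.2)).trans hv
    rw [← hl] at h
    have h1 : 0 ≤ l * ((H 0 0).re * ‖E.e v.1‖ ^ 2) := by positivity
    have h2 : 0 ≤ l * ((H 1 1).re * ‖E.e v.2‖ ^ 2) := by positivity
    constructor
    · refine hsq ?_
      rw [le_div_iff₀ (by positivity)]
      linarith
    · refine hsq ?_
      rw [le_div_iff₀ (by positivity)]
      linarith
  obtain ⟨v, ⟨hv, hvv⟩, hmin⟩ := Set.exists_min_image {v | Q v ∧ f v ≤ f v₀} f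
    (hfin.subset fun v h => h.2) ⟨v₀, hv₀, le_rfl⟩
  refine ⟨v, hv, fun u hu => ?_⟩
  rcases le_total (f u) (f v₀) with h | h
  · exact hmin u ⟨hu, h⟩
  · exact hvv.trans h

/-- Reduction theory: every positive form is almost reduced with respect to some pair of
independent vectors of `O²` of bounded determinant. -/
theorem exists_reduction [IsDomain O] :
    ∃ κ C B : ℝ, 0 < κ ∧ κ < 1 ∧ 1 < C ∧ ∀ H ∈ cone 1, ∃ P : Matrix (Fin 2) (Fin 2) O,
      P.det ≠ 0 ∧ ‖E.e P.det‖ ≤ B ∧ (E.e.mapMatrix P)ᴴ * H * E.e.mapMatrix P ∈ siegel κ C := by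
  obtain ⟨N, hN⟩ := E.exists_approximation
  have hσ := E.σ_pos
  set C : ℝ := 2 + E.σ with hC
  set A : ℝ := C ^ 2 * ((N : ℝ) ^ 2 + 1) with hA
  have hA0 : 0 < A := by positivity
  refine ⟨A / (A + 1 / 2), C, (N : ℝ) ^ 2, by positivity, ?_, by linarith, fun H hH => ?_⟩
  · rw [div_lt_one (by positivity)]
    linarith
  -- Successive minima: `v` is a shortest nonzero vector, `w` a shortest vector independent of `v`.
  -- They need not form a basis of `O²`, hence the bounded determinant.
  obtain ⟨v, hv, hvmin⟩ := E.exists_min hH (fun v => v ≠ 0) ⟨(1, 0), by simp⟩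
  obtain ⟨w, hw, hwmin⟩ := E.exists_min hH (fun u => v.1 * u.2 - v.2 * u.1 ≠ 0) (by
    by_cases h : v.1 = 0
    · refine ⟨(1, 0), fun h' => hv (Prod.ext h ?_)⟩
      simpa using h'
    · exact ⟨(0, 1), by simpa using h⟩)
  set P : Matrix (Fin 2) (Fin 2) O := !![v.1, w.1; v.2, w.2] with hP
  have hdet : P.det = v.1 * w.2 - v.2 * w.1 := by
    rw [hP, det_fin_two_of]
    ring
  set g := E.e.mapMatrix P with hg
  have hg00 : g 0 0 = E.e v.1 := rfl
  have hg01 : g 0 1 = E.e w.1 := rfl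
  have hg10 : g 1 0 = E.e v.2 := rfl
  have hg11 : g 1 1 = E.e w.2 := rfl
  have hgdet : g.det = E.e P.det := (E.e.map_det P).symm
  have hgdet0 : g.det ≠ 0 := by
    rw [hgdet, map_ne_zero_iff _ E.inj, hdet]
    exact hw
  have hH' := conj_mem_cone hH hgdet0
  set H' := gᴴ * H * g with hH'def
  have hpv : (H' 0 0).re = val H (E.e v.1) (E.e v.2) := re_conj_apply_self hH.1 g 0
  have hqw : (H' 1 1).re = val H (E.e w.1) (E.e w.2) := re_conj_apply_self hH.1 g 1
  have hp := hH'.2.1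
  have hq := hH'.2.2.1
  have hval : ∀ x y, val H' x y = val H (E.e v.1 * x + E.e w.1 * y) (E.e v.2 * x + E.e w.2 * y) :=
    fun x y => val_conj hH.1 g x y
  have hpmin : ∀ u : O × O, u ≠ 0 → (H' 0 0).re ≤ val H (E.e u.1) (E.e u.2) := fun u hu =>
    hpv.le.trans (hvmin u hu)
  have hqmin : ∀ u : O × O, v.1 * u.2 - v.2 * u.1 ≠ 0 →
      (H' 1 1).re ≤ val H (E.e u.1) (E.e u.2) := fun u hu => hqw.le.trans (hwmin u hu)
  have hpq : (H' 0 0).re ≤ (H' 1 1).re := by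
    rw [hqw]
    refine hpmin w ?_
    rintro rfl
    simp at hw
  have hcomb : ∀ a b : O, val H' (E.e a) (E.e b) =
      val H (E.e (a * v.1 + b * w.1)) (E.e (a * v.2 + b * w.2)) := fun a b => by
    rw [hval]
    simp only [map_add, map_mul, mul_comm]
  -- the shear condition
  have hshear : ∀ t : O, 0 ≤ (H' 0 0).re * ‖E.e t‖ ^ 2 + 2 * (star (E.e t) * H' 0 1).re :=
    fun t => by
      have h := hqmin (t * v.1 + 1 * w.1, t * v.2 + 1 * w.2) (by
        refine fun h => hw ?_
        dsimp only at h
        linear_combination h)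
      rw [← hcomb, val, map_one, norm_one, mul_one] at h
      linarith
  have hz : ‖H' 0 1‖ < C * (H' 0 0).re := by
    have h1 := hshear 1
    have h2 := hshear (-1)
    have h3 := hshear E.s
    have h4 := hshear (-E.s)
    simp only [map_one, map_neg, norm_neg, norm_one, star_one, star_neg, E.e_s, norm_mul,
      Complex.norm_real, Complex.norm_I, Real.norm_eq_abs, abs_of_pos hσ, star_mul',
      Complex.star_def, Complex.conj_ofReal, Complex.conj_I, neg_mul, mul_neg, neg_neg,
      Complex.neg_re, Complex.mul_re, Complex.mul_im, Complex.ofReal_re, Complex.ofReal_im,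
      Complex.I_re, Complex.I_im, one_mul, mul_one, mul_zero, zero_mul, sub_zero, zero_sub,
      add_zero, one_pow] at h1 h2 h3 h4
    have him : |(H' 0 1).im| ≤ (H' 0 0).re * E.σ / 2 := by
      rw [abs_le]
      constructor
      · refine le_of_mul_le_mul_left (a0 := hσ) ?_
        linarith
      · refine le_of_mul_le_mul_left (a0 := hσ) ?_
        linarith
    have hre : |(H' 0 1).re| ≤ (H' 0 0).re / 2 := by
      rw [abs_le]
      constructor <;> linarith
    have := Complex.norm_le_abs_re_add_abs_im (H' 0 1)
    have h5 := mul_pos hp hσ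
    rw [hC]
    linarith
  refine ⟨P, hdet ▸ hw, ?_, ⟨hH'.1, hp, hq, ?_⟩, ?_, hz⟩
  · -- the determinant is bounded
    have hbasis : ∀ c : O × O, ∃ n : ℕ, 1 ≤ n ∧ n ≤ N ∧ ∃ a b : O,
        a * v.1 + b * w.1 = n * c.1 ∧ a * v.2 + b * w.2 = n * c.2 := by
      intro c
      set α : ℂ := (E.e c.1 * E.e w.2 - E.e c.2 * E.e w.1) / g.det with hα
      set β : ℂ := (E.e v.1 * E.e c.2 - E.e v.2 * E.e c.1) / g.det with hβ
      have hgd : g.det = E.e v.1 * E.e w.2 - E.e w.1 * E.e v.2 := by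
        rw [det_fin_two, hg00, hg01, hg10, hg11]
      have h1 : α * E.e v.1 + β * E.e w.1 = E.e c.1 := by
        rw [hα, hβ]
        field_simp
        rw [hgd]
        ring
      have h2 : α * E.e v.2 + β * E.e w.2 = E.e c.2 := by
        rw [hα, hβ]
        field_simp
        rw [hgd]
        ring
      obtain ⟨n, hn1, hnN, a, ha⟩ := hN ![α, β]
      have ha0 := ha 0
      have ha1 := ha 1
      simp only [cons_val_zero, cons_val_one] at ha0 ha1
      refine ⟨n, hn1, hnN, a 0, a 1, ?_⟩
      set x : ℂ := n * α - E.e (a 0) with hx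
      set y : ℂ := n * β - E.e (a 1) with hy
      set u : O × O := (n * c.1 - (a 0 * v.1 + a 1 * w.1), n * c.2 - (a 0 * v.2 + a 1 * w.2))
        with hu
      have hu1 : E.e u.1 = E.e v.1 * x + E.e w.1 * y := by
        simp only [hu, hx, hy, map_sub, map_add, map_mul, map_natCast, ← h1]
        ring
      have hu2 : E.e u.2 = E.e v.2 * x + E.e w.2 * y := by
        simp only [hu, hx, hy, map_sub, map_add, map_mul, map_natCast, ← h2]
        ring
      have hxsq : ‖x‖ ^ 2 ≤ 1 / 9 := by nlinarith [norm_nonneg x]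
      have hysq : ‖y‖ ^ 2 ≤ 1 / 9 := by nlinarith [norm_nonneg y]
      have huval : val H (E.e u.1) (E.e u.2) = val H' x y := by rw [hval, hu1, hu2]
      -- The remainder `u` has coordinates of modulus at most `1 / 3` in `v, w`. If nonzero, it
      -- would be shorter than `v` when dependent on `v`, and shorter than `w` otherwise.
      have hu0 : u = 0 := by
        by_contra hune
        by_cases hvu : v.1 * u.2 - v.2 * u.1 = 0
        · have hy0 : y = 0 := by
            have h3 : y * g.det = 0 := by
              have h4 := congrArg E.e hvu
              rw [map_sub, map_mul, map_mul, hu1, hu2, map_zero] at h4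
              rw [hgd]
              linear_combination h4
            exact (mul_eq_zero.mp h3).resolve_right hgdet0
          have h3 := hpmin u hune
          rw [huval, hy0, val] at h3
          simp only [norm_zero, mul_zero, Complex.zero_re] at h3
          nlinarith
        · have h3 := hqmin u hvu
          rw [huval] at h3
          have h4 := val_le hH' x y
          nlinarith
      have e1 := congrArg Prod.fst hu0
      have e2 := congrArg Prod.snd hu0
      exact ⟨(sub_eq_zero.mp e1).symm, (sub_eq_zero.mp e2).symm⟩
    obtain ⟨n, hn1, hnN, a, b, h1, h2⟩ := hbasis (1, 0)
    obtain ⟨n', hn1', hnN', a', b', h1', h2'⟩ := hbasis (0, 1)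
    simp only [mul_one, mul_zero] at h1 h2 h1' h2'
    -- Multiples `n` and `n'` of the standard basis vectors lie in the span of `v, w`, so `P.det`
    -- divides `n * n'`.
    have hmul : P.det * (a * b' - a' * b) = ((n * n' : ℕ) : O) := by
      rw [hdet, Nat.cast_mul, ← h1, ← h2']
      linear_combination (-(a' * v.1 + b' * w.1)) * h2
    have hmul' := congrArg (fun t => ‖E.e t‖) hmul
    simp only [map_mul, map_natCast, norm_mul, Complex.norm_natCast] at hmul'
    have hne : a * b' - a' * b ≠ 0 := by
      intro h0
      rw [h0, map_zero, norm_zero, mul_zero] at hmul'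
      have : (0 : ℝ) < ((n * n' : ℕ) : ℝ) := by exact_mod_cast Nat.mul_pos hn1 hn1'
      linarith
    have hle := E.one_le_norm hne
    calc ‖E.e P.det‖ ≤ ‖E.e P.det‖ * ‖E.e (a * b' - a' * b)‖ :=
          le_mul_of_one_le_right (norm_nonneg _) hle
      _ = ((n * n' : ℕ) : ℝ) := hmul'
      _ ≤ (N : ℝ) ^ 2 := by
        rw [sq]
        exact_mod_cast Nat.mul_le_mul hnN hnN'
  · -- the angle condition
    obtain ⟨n, hn1, hnN, a, ha⟩ := hN ![H' 0 1 / (H' 0 0).re, 0]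
    have ha0 := ha 0
    simp only [cons_val_zero] at ha0
    have hpc : ((H' 0 0).re : ℂ) ≠ 0 := by exact_mod_cast hp.ne'
    have hne : (-a 0 * v.1 + n * w.1, -a 0 * v.2 + n * w.2) ≠ (0 : O × O) := by
      intro h
      have e1 := congrArg Prod.fst h
      have e2 := congrArg Prod.snd h
      simp only [Prod.fst_zero, Prod.snd_zero] at e1 e2
      have h3 : (n : O) * (v.1 * w.2 - v.2 * w.1) = 0 := by
        linear_combination v.1 * e2 - v.2 * e1
      have hn0 : (n : O) ≠ 0 := by
        rw [← map_ne_zero_iff _ E.inj, map_natCast]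
        exact_mod_cast (by omega : n ≠ 0)
      exact hw ((mul_eq_zero.mp h3).resolve_left hn0)
    -- The vector `n w - a v` is no shorter than `v`. Completing the square turns this into `p² ≤ p²
    -- / 9 + n² * (p q - |z|²)`, so `p²` is bounded by a multiple of the determinant; so is `|z|²`,
    -- as `|z| < C p`.
    have h1 := hpmin _ hne
    rw [← hcomb] at h1
    have h2 := mul_val H' (E.e (-a 0)) (E.e n)
    have h3 : ‖((H' 0 0).re : ℂ) * E.e (-a 0) + H' 0 1 * E.e n‖ ≤ (H' 0 0).re * (1 / 3) := by
      have : ((H' 0 0).re : ℂ) * E.e (-a 0) + H' 0 1 * E.e n =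
          (H' 0 0).re * (n * (H' 0 1 / (H' 0 0).re) - E.e (a 0)) := by
        rw [map_neg, map_natCast]
        field_simp
        ring
      rw [this, norm_mul, Complex.norm_real, Real.norm_eq_abs, abs_of_pos hp]
      exact mul_le_mul_of_nonneg_left ha0 hp.le
    have h4 : ‖((H' 0 0).re : ℂ) * E.e (-a 0) + H' 0 1 * E.e n‖ ^ 2 ≤
        ((H' 0 0).re * (1 / 3)) ^ 2 := pow_le_pow_left₀ (norm_nonneg _) h3 2
    rw [map_natCast, Complex.norm_natCast] at h2
    have hd : 0 < (H' 0 0).re * (H' 1 1).re - ‖H' 0 1‖ ^ 2 := by linarith [hH'.2.2.2]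
    have h5 : ((H' 0 0).re * (H' 1 1).re - ‖H' 0 1‖ ^ 2) * (n : ℝ) ^ 2 ≤
        ((H' 0 0).re * (H' 1 1).re - ‖H' 0 1‖ ^ 2) * ((N : ℝ) ^ 2 + 1) := by
      refine mul_le_mul_of_nonneg_left ?_ hd.le
      have : (n : ℝ) ^ 2 ≤ (N : ℝ) ^ 2 := pow_le_pow_left₀ (Nat.cast_nonneg n)
        (by exact_mod_cast hnN) 2
      linarith
    rw [map_natCast] at h1 h4
    have h6 := mul_le_mul_of_nonneg_left h1 hp.le
    have h7 : 1 / 2 * (H' 0 0).re ^ 2 ≤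
        ((H' 0 0).re * (H' 1 1).re - ‖H' 0 1‖ ^ 2) * ((N : ℝ) ^ 2 + 1) := by
      nlinarith
    have h8 : ‖H' 0 1‖ ^ 2 < C ^ 2 * (H' 0 0).re ^ 2 := by
      rw [← mul_pow]
      exact pow_lt_pow_left₀ hz (norm_nonneg _) two_ne_zero
    have h9 : 1 / 2 * ‖H' 0 1‖ ^ 2 < A * ((H' 0 0).re * (H' 1 1).re - ‖H' 0 1‖ ^ 2) :=
      calc 1 / 2 * ‖H' 0 1‖ ^ 2 < 1 / 2 * (C ^ 2 * (H' 0 0).re ^ 2) := by linarith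
        _ = C ^ 2 * (1 / 2 * (H' 0 0).re ^ 2) := by ring
        _ ≤ C ^ 2 * (((H' 0 0).re * (H' 1 1).re - ‖H' 0 1‖ ^ 2) * ((N : ℝ) ^ 2 + 1)) :=
          mul_le_mul_of_nonneg_left h7 (sq_nonneg C)
        _ = _ := by rw [hA]; ring
    rw [div_mul_eq_mul_div, lt_div_iff₀ (by positivity)]
    linarith
  · have : (1 : ℝ) < C := by linarith
    nlinarith

end DiscreteEmbedding

/-! ### The cover of the cone by Siegel sets -/

namespace DiscreteEmbedding

open Matrix HermitianForm

variable {O : Type} [CommRing O] (E : DiscreteEmbedding O)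

theorem finite_matrix (M : ℝ) :
    {P : Matrix (Fin 2) (Fin 2) O | ∀ i j, ‖E.e (P i j)‖ ≤ M}.Finite := by
  have h := Set.Finite.pi fun _ : Fin 2 => Set.Finite.pi fun _ : Fin 2 => E.finite M
  refine h.subset fun P hP i _ j _ => hP i j

/-- Up to `SL₂(O)` there are finitely many matrices of nonzero bounded determinant. -/
theorem exists_finite_reps [IsDomain O] (B : ℝ) :
    ∃ I : Set (Matrix (Fin 2) (Fin 2) O), I.Finite ∧ (∀ P ∈ I, P.det ≠ 0) ∧
      ∀ P : Matrix (Fin 2) (Fin 2) O, P.det ≠ 0 → ‖E.e P.det‖ ≤ B →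
        ∃ γ : SpecialLinearGroup (Fin 2) O, ∃ P₀ ∈ I, P = γ * P₀ := by
  have hred : ∀ δ x : O, δ ≠ 0 → ‖E.e δ‖ ≤ B → ∃ a, ‖E.e (x - δ * a)‖ ≤ B * (1 + E.σ) :=
    fun δ x hδ hB => by
      obtain ⟨a, ha⟩ := E.exists_norm_sub_le (E.e x / E.e δ)
      refine ⟨a, ?_⟩
      have hδ' : E.e δ ≠ 0 := (map_ne_zero_iff _ E.inj).mpr hδ
      have : E.e (x - δ * a) = E.e δ * (E.e x / E.e δ - E.e a) := by
        rw [map_sub, map_mul]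
        field_simp
      rw [this, norm_mul]
      exact mul_le_mul hB ha (norm_nonneg _) ((norm_nonneg _).trans hB)
  have hredM : ∀ P : Matrix (Fin 2) (Fin 2) O, P.det ≠ 0 → ‖E.e P.det‖ ≤ B →
      ∃ A : Matrix (Fin 2) (Fin 2) O, ∀ i j, ‖E.e ((P - P.det • A) i j)‖ ≤ B * (1 + E.σ) :=
    fun P hP hB => by
      choose A hA using fun i j => hred P.det (P i j) hP hB
      exact ⟨of A, fun i j => hA i j⟩
  choose! A hA using hredM
  -- A matrix is classified by its determinant `δ` and a bounded representative modulo `δ`; there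
  -- are finitely many such pairs.
  set S : Set (Matrix (Fin 2) (Fin 2) O) := {P | P.det ≠ 0 ∧ ‖E.e P.det‖ ≤ B}
  set c : Matrix (Fin 2) (Fin 2) O → O × Matrix (Fin 2) (Fin 2) O :=
    fun P => (P.det, P - P.det • A P) with hc
  obtain ⟨I, hIS, hbij⟩ := Set.exists_subset_bijOn S c
  have hfin : (c '' S).Finite := by
    refine ((E.finite B).prod (E.finite_matrix (B * (1 + E.σ)))).subset ?_
    rintro _ ⟨P, ⟨hP, hB⟩, rfl⟩
    exact ⟨hB, hA P hP hB⟩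
  refine ⟨I, ?_, fun P hP => (hIS hP).1, fun P hP hB => ?_⟩
  · exact Set.Finite.of_finite_image (hbij.image_eq ▸ hfin) hbij.injOn
  · obtain ⟨P₀, hP₀, hcP⟩ := hbij.surjOn ⟨P, ⟨hP, hB⟩, rfl⟩
    have hd : P₀.det = P.det := congrArg Prod.fst hcP
    have hr : P₀ - P.det • A P₀ = P - P.det • A P := by
      have := congrArg Prod.snd hcP
      simp only [hc] at this
      rwa [hd] at this
    -- This is `P * P₀⁻¹`: it is integral because `P - P₀` is divisible by the common determinant
    -- and `P₀⁻¹` is the adjugate over it.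
    set γ : Matrix (Fin 2) (Fin 2) O := 1 + (A P - A P₀) * P₀.adjugate with hγ
    have hmul : γ * P₀ = P := by
      rw [hγ, add_mul, one_mul, Matrix.mul_assoc, adjugate_mul, hd, Matrix.mul_smul, mul_one,
        smul_sub, ← sub_eq_zero]
      rw [← sub_eq_zero] at hr
      rw [← hr]
      abel
    have hγdet : γ.det = 1 := by
      have := congrArg det hmul
      rw [det_mul, hd] at this
      exact mul_right_cancel₀ hP (by rw [this, one_mul])
    exact ⟨⟨γ, hγdet⟩, P₀, hP₀, hmul.symm⟩

/-- The same for a subgroup of finite index. -/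
theorem exists_finite_reps_subgroup [IsDomain O] (Γ : Subgroup (SpecialLinearGroup (Fin 2) O))
    [Γ.FiniteIndex] (B : ℝ) :
    ∃ I : Set (Matrix (Fin 2) (Fin 2) O), I.Finite ∧ (∀ P ∈ I, P.det ≠ 0) ∧
      ∀ P : Matrix (Fin 2) (Fin 2) O, P.det ≠ 0 → ‖E.e P.det‖ ≤ B →
        ∃ γ ∈ Γ, ∃ P₀ ∈ I, P = γ * P₀ := by
  obtain ⟨I, hfin, hI, hrep⟩ := E.exists_finite_reps B
  refine ⟨⋃ t : SpecialLinearGroup (Fin 2) O ⧸ Γ,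
    (fun P => (t.out⁻¹).1 * P) '' I,
    Set.finite_iUnion fun t => hfin.image _, ?_, fun P hP hB => ?_⟩
  · intro P hP
    obtain ⟨t, P₀, hP₀, rfl⟩ := Set.mem_iUnion.mp hP
    have h1 : (t.out⁻¹).1.det = 1 := (t.out⁻¹).2
    simpa only [det_mul, h1, one_mul] using hI P₀ hP₀
  · obtain ⟨γ, P₀, hP₀, rfl⟩ := hrep P hP hB
    set t : SpecialLinearGroup (Fin 2) O ⧸ Γ := QuotientGroup.mk γ⁻¹ with ht
    have h : t.out⁻¹ * γ⁻¹ ∈ Γ := QuotientGroup.eq.mp (Quotient.out_eq' t)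
    refine ⟨γ * t.out, by simpa using Γ.inv_mem h, _,
      Set.mem_iUnion.mpr ⟨t, P₀, hP₀, rfl⟩, ?_⟩
    change γ.1 * P₀ = (γ * t.out).1 * ((t.out⁻¹).1 * P₀)
    rw [← Matrix.mul_assoc]
    exact congrArg (fun x : SpecialLinearGroup (Fin 2) O => x.1 * P₀)
      (mul_inv_cancel_right γ t.out).symm

theorem locallyConvexSpace_matrix : LocallyConvexSpace ℝ (Matrix (Fin 2) (Fin 2) ℂ) :=
  inferInstanceAs (LocallyConvexSpace ℝ (Fin 2 → Fin 2 → ℂ))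

theorem locallyPathConnectedSpace_cone : LocallyPathConnectedSpace (cone 1) :=
  have := locallyConvexSpace_matrix
  (convex_cone one_pos).locallyPathConnectedSpace

theorem one_mem_cone : (1 : Matrix (Fin 2) (Fin 2) ℂ) ∈ cone 1 :=
  (one_mem_siegel one_pos one_lt_two).1

theorem simplyConnectedSpace_cone : SimplyConnectedSpace (cone 1) :=
  have := (convex_cone one_pos).contractibleSpace ⟨1, one_mem_cone⟩
  SimplyConnectedSpace.ofContractible _

/-- The set is the preimage, within a convex cone, of a convex cone under a linear map, hence
convex. -/
theorem isPreconnected_conj_siegel {κ C : ℝ} (hκ : 0 < κ) (g : Matrix (Fin 2) (Fin 2) ℂ) :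
    IsPreconnected {H : cone 1 | gᴴ * H.1 * g ∈ siegel κ C} := by
  rw [← Topology.IsInducing.subtypeVal.isPreconnected_image]
  refine Convex.isPreconnected (convex_of_add_smul ?_ ?_)
  · rintro _ ⟨A, hA, rfl⟩ _ ⟨B, hB, rfl⟩
    refine ⟨⟨A.1 + B.1, add_mem_cone one_pos A.2 B.2⟩, ?_, rfl⟩
    change gᴴ * (A.1 + B.1) * g ∈ siegel κ C
    have h := (convex_siegel (C := C) hκ) hA hB (a := 1 / 2) (b := 1 / 2) (by norm_num)
      (by norm_num) (by norm_num)
    have h2 := smul_mem_siegel (t := 2) two_pos h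
    rw [smul_add, smul_smul, smul_smul] at h2
    norm_num at h2
    rwa [Matrix.mul_add, Matrix.add_mul]
  · rintro t ht _ ⟨A, hA, rfl⟩
    refine ⟨⟨t • A.1, smul_mem_cone ht A.2⟩, ?_, rfl⟩
    change gᴴ * (t • A.1) * g ∈ siegel κ C
    rw [Matrix.mul_smul, Matrix.smul_mul]
    exact smul_mem_siegel ht hA

theorem isOpen_conj_siegel {κ C : ℝ} {g : Matrix (Fin 2) (Fin 2) ℂ} (hg : g.det ≠ 0) :
    IsOpen {H : cone 1 | gᴴ * H.1 * g ∈ siegel κ C} := by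
  have hc : Continuous fun H : cone 1 => gᴴ * H.1 * g :=
    (continuous_const.matrix_mul continuous_subtype_val).matrix_mul continuous_const
  have he : ∀ i j, Continuous fun H : cone 1 => (gᴴ * H.1 * g) i j := fun i j =>
    hc.matrix_elem i j
  have hr : ∀ i j, Continuous fun H : cone 1 => ((gᴴ * H.1 * g) i j).re := fun i j =>
    Complex.continuous_re.comp (he i j)
  -- Hermitian symmetry and positivity are automatic for invertible `g`, leaving three strict
  -- inequalities.
  have : {H : cone 1 | gᴴ * H.1 * g ∈ siegel κ C} =
      {H : cone 1 | ‖(gᴴ * H.1 * g) 0 1‖ ^ 2 <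
        κ * (((gᴴ * H.1 * g) 0 0).re * ((gᴴ * H.1 * g) 1 1).re)} ∩
      ({H : cone 1 | ((gᴴ * H.1 * g) 0 0).re < C * ((gᴴ * H.1 * g) 1 1).re} ∩
      {H : cone 1 | ‖(gᴴ * H.1 * g) 0 1‖ < C * ((gᴴ * H.1 * g) 0 0).re}) := by
    ext H
    have h := conj_mem_cone H.2 hg
    exact ⟨fun ⟨⟨_, _, _, h4⟩, h5, h6⟩ => ⟨h4, h5, h6⟩,
      fun ⟨h4, h5, h6⟩ => ⟨⟨h.1, h.2.1, h.2.2.1, h4⟩, h5, h6⟩⟩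
  rw [this]
  exact (isOpen_lt ((he 0 1).norm.pow 2) (continuous_const.mul ((hr 0 0).mul (hr 1 1)))).inter
    ((isOpen_lt (hr 0 0) (continuous_const.mul (hr 1 1))).inter
      (isOpen_lt (he 0 1).norm (continuous_const.mul (hr 0 0))))

/-- A subgroup of finite index of `SL₂(O)` is finitely presented. -/
theorem nonempty_triangularPresentation [IsDomain O] (E : DiscreteEmbedding O)
    (Γ : Subgroup (SpecialLinearGroup (Fin 2) O)) [Γ.FiniteIndex] :
    Nonempty (TriangularPresentation Γ) := by
  obtain ⟨κ, C, B, hκ, hκ1, hC, hred⟩ := E.exists_reduction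
  obtain ⟨I, hfin, hI, hrep⟩ := E.exists_finite_reps_subgroup Γ B
  have : Finite I := hfin
  have := locallyPathConnectedSpace_cone
  have := simplyConnectedSpace_cone
  let m : Γ → Matrix (Fin 2) (Fin 2) O → Matrix (Fin 2) (Fin 2) O := fun γ P => γ.1.1 * P
  have hm : ∀ a b P, m (a * b) P = m a (m b P) := fun a b P =>
    Matrix.mul_assoc a.1.1 b.1.1 P
  have hm' : ∀ a P, m a P = m a 1 * P := fun a P => by simp only [m, mul_one]
  have hmdet : ∀ a P, (m a P).det = P.det := fun a P => by
    have h : a.1.1.det = 1 := a.1.2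
    simp only [m, det_mul, h, one_mul]
  let f : Γ × I → Matrix (Fin 2) (Fin 2) ℂ := fun t => E.e.mapMatrix (m t.1 t.2.1)
  have hfdet : ∀ t, (f t).det ≠ 0 := fun t => by
    rw [← RingHom.map_det, hmdet]
    exact (map_ne_zero_iff _ E.inj).mpr (hI _ t.2.2)
  let V : Γ × I → Set (cone 1) := fun t => {H | (f t)ᴴ * H.1 * f t ∈ siegel κ C}
  refine _root_.nonempty_triangularPresentation V (fun t => isOpen_conj_siegel (hfdet t))
    (fun t => isPreconnected_conj_siegel hκ _) (fun t => ?_) (fun H => ?_) ?_ fun P Q => ?_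
  · have hu : IsUnit (f t).det := (hfdet t).isUnit
    have hinv : ((f t)⁻¹).det ≠ 0 := by
      rw [det_nonsing_inv, Ring.inverse_eq_inv']
      exact inv_ne_zero (hfdet t)
    refine ⟨⟨((f t)⁻¹)ᴴ * 1 * (f t)⁻¹, conj_mem_cone one_mem_cone hinv⟩, ?_⟩
    change (f t)ᴴ * (((f t)⁻¹)ᴴ * 1 * (f t)⁻¹) * f t ∈ siegel κ C
    have : (f t)ᴴ * (((f t)⁻¹)ᴴ * 1 * (f t)⁻¹) * f t = 1 := by
      rw [mul_one, ← Matrix.mul_assoc, ← conjTranspose_mul, nonsing_inv_mul _ hu,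
        conjTranspose_one, one_mul, nonsing_inv_mul _ hu]
    rw [this]
    exact one_mem_siegel hκ hC
  · obtain ⟨P, hP, hB, hmem⟩ := hred H.1 H.2
    obtain ⟨γ, hγ, P₀, hP₀, rfl⟩ := hrep P hP hB
    exact ⟨(⟨γ, hγ⟩, ⟨P₀, hP₀⟩), hmem⟩
  · rintro c a b i j ⟨H, hHi, hHj⟩
    set g : Matrix (Fin 2) (Fin 2) ℂ := E.e.mapMatrix (m c⁻¹ 1) with hg
    have hgdet : g.det ≠ 0 := by
      rw [hg, ← RingHom.map_det, hmdet, det_one, map_one]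
      exact one_ne_zero
    have hgf : ∀ d k, g * f (c * d, k) = f (d, k) := fun d k => by
      simp only [hg, f]
      rw [← map_mul, ← hm', ← hm, inv_mul_cancel_left]
    have hconj : ∀ d k, (f (c * d, k))ᴴ * (gᴴ * H.1 * g) * f (c * d, k) =
        (f (d, k))ᴴ * H.1 * f (d, k) := fun d k => by
      rw [← hgf d k, conjTranspose_mul]
      simp only [Matrix.mul_assoc]
    refine ⟨⟨gᴴ * H.1 * g, conj_mem_cone H.2 hgdet⟩, ?_, ?_⟩
    · change (f (c * a, i))ᴴ * (gᴴ * H.1 * g) * f (c * a, i) ∈ siegel κ C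
      rw [hconj]
      exact hHi
    · change (f (c * b, j))ᴴ * (gᴴ * H.1 * g) * f (c * b, j) ∈ siegel κ C
      rw [hconj]
      exact hHj
  · obtain ⟨M, hM⟩ := exists_norm_le_of_conj_mem_siegel (κ := κ) (C := C)
      (B := ‖E.e (P.1.det * Q.1.det)‖) hκ hκ1 hC
    have hPdet := hI _ P.2
    have hQdet := hI _ Q.2
    -- The adjugate replaces `P⁻¹` to keep the entries in `O`. This only rescales the form by `‖E.e
    -- P.det‖ ^ 2`, which preserves the Siegel set, and `a` is recovered from the product since both
    -- determinants are nonzero.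
    refine Set.Finite.of_finite_image (f := fun a => P.1.adjugate * m a Q.1)
      ((E.finite_matrix M).subset ?_) fun a _ b _ hab => ?_
    · rintro _ ⟨a, ⟨H, hP, hQ⟩, rfl⟩
      have hPf : f (1, P) = E.e.mapMatrix P.1 :=
        congrArg E.e.mapMatrix (Matrix.one_mul P.1)
      have hPQ : E.e.mapMatrix P.1 * E.e.mapMatrix (P.1.adjugate * m a Q.1) =
          E.e P.1.det • f (a, Q) := by
        rw [← map_mul, ← Matrix.mul_assoc, mul_adjugate, Matrix.smul_mul, one_mul]
        ext i j
        simp [f]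
      have hGdet : (P.1.adjugate * m a Q.1).det = P.1.det * Q.1.det := by
        rw [det_mul, hmdet, det_adjugate, Fintype.card_fin, pow_one]
      have hconj : (E.e.mapMatrix (P.1.adjugate * m a Q.1))ᴴ *
          ((f (1, P))ᴴ * H.1 * f (1, P)) * E.e.mapMatrix (P.1.adjugate * m a Q.1) =
          (‖E.e P.1.det‖ ^ 2) • ((f (a, Q))ᴴ * H.1 * f (a, Q)) := by
        have h1 : (E.e.mapMatrix (P.1.adjugate * m a Q.1))ᴴ *
            ((f (1, P))ᴴ * H.1 * f (1, P)) * E.e.mapMatrix (P.1.adjugate * m a Q.1) =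
            (f (1, P) * E.e.mapMatrix (P.1.adjugate * m a Q.1))ᴴ * H.1 *
              (f (1, P) * E.e.mapMatrix (P.1.adjugate * m a Q.1)) := by
          rw [conjTranspose_mul]
          simp only [Matrix.mul_assoc]
        rw [h1, hPf, hPQ, conjTranspose_smul, Matrix.smul_mul, Matrix.smul_mul, Matrix.mul_smul,
          smul_smul, Complex.star_def, ← Complex.normSq_eq_conj_mul_self,
          Complex.normSq_eq_norm_sq]
        ext i j
        simp
      intro i j
      refine hM _ hP (E.e.mapMatrix (P.1.adjugate * m a Q.1)) (fun i j h => ?_) ?_ ?_ ?_ i j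
      · exact E.one_le_norm fun h0 => h (by rw [RingHom.mapMatrix_apply, map_apply, h0, map_zero])
      · rw [← RingHom.map_det, hGdet]
        exact (map_ne_zero_iff _ E.inj).mpr (mul_ne_zero hPdet hQdet)
      · rw [← RingHom.map_det, hGdet]
      · rw [hconj]
        refine smul_mem_siegel (pow_pos (norm_pos_iff.mpr ?_) 2) hQ
        exact (map_ne_zero_iff _ E.inj).mpr hPdet
    · have h1 : P.1 * (P.1.adjugate * m a Q.1) * Q.1.adjugate =
          P.1 * (P.1.adjugate * m b Q.1) * Q.1.adjugate := by
        dsimp only at hab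
        rw [hab]
      have h2 : ∀ d : Γ, P.1 * (P.1.adjugate * m d Q.1) * Q.1.adjugate =
          (P.1.det * Q.1.det) • d.1.1 := fun d => by
        rw [← Matrix.mul_assoc P.1, mul_adjugate, Matrix.smul_mul, one_mul, Matrix.smul_mul,
          Matrix.mul_assoc, mul_adjugate, Matrix.mul_smul, mul_one, smul_smul]
      rw [h2, h2] at h1
      refine Subtype.ext (Subtype.ext ?_)
      exact smul_right_injective _ (mul_ne_zero hPdet hQdet) h1

end DiscreteEmbedding

/-! ### The torsion bound for Bianchi groups -/

theorem proposition7p3 (D : ℕ) (hD : Squarefree D) (Γ : Subgroup (BianchiGroup D))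
    (hfin : Γ.FiniteIndex) (htf : ∀ g ∈ Γ, IsOfFinOrder g → g = 1) :
    ∃ c : ℝ, ∀ m : ℕ, 1 ≤ m →
      Finite (AddCommGroup.torsion (groupCohomology (LambdaBar D Γ m) 2)) ∧
      Real.log (Nat.card (AddCommGroup.torsion (groupCohomology (LambdaBar D Γ m) 2)))
        ≤ c * (m : ℝ) ^ 2 := by
  have hD0 : (0 : ℝ) < D := by
    exact_mod_cast Nat.pos_of_ne_zero hD.ne_zero
  obtain ⟨s, hs⟩ := ImagQuad.exists_toComplex_eq D
  let E : DiscreteEmbedding (ImagQuadIntegers D) :=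
    { e := ImagQuad.toComplex D
      inj := ImagQuad.toComplex_injective D
      finite := ImagQuad.finite_norm_le D
      s := s
      σ := Real.sqrt D
      σ_pos := Real.sqrt_pos.mpr hD0
      e_s := hs }
  obtain ⟨P⟩ := E.nonempty_triangularPresentation Γ
  obtain ⟨c, hc⟩ := exists_log_card_torsion_H2_le Γ P
  exact ⟨c, fun m hm => hc m hm _ rfl⟩
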